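/- For $\phi,\psi\in L^2(\mathbb R)$ (inner product $\langle f,g\rangle=\int f\bar g$) let $A=A_{\phi,\psi}$ be the operator $(Af)(x)=xf(x)+\langle f,\phi\rangle\psi(x)$ in $L^2(\mathbb R)$ with domain $$\Big\{f\in L^2(\mathbb R): xf\in L^2(\mathbb R),\ \lim_{R\to\infty}\int_{-R}^R f\,dx=0\Big\},$$ and let $\widetilde A=A_{\psi,\phi}$. Put $\Gamma_1u=\lim_{R\to\infty}\int_{-R}^Ru\,dx$ and $\Gamma_2u=c_u$, where $c_u\in\mathbb C$ is the constant with $xu-c_u\in L^2(\mathbb R)$. For $B\in\mathbb C$ let $A_B$ be the restriction of $\widetilde A^*$ to $\ker(\Gamma_1-B\Gamma_2)$, and for $\lambda\in\rho(A_B)$ let $S_{\lambda,B}h=u$ be the solution of $(\widetilde A^*-\lambda)u=0$, $(\Gamma_1-B\Gamma_2)u=h$. For $\mu_0\in\rho(A_B)$ let $$\mathcal S=\mathcal S_B=\mathrm{Span}_{\delta\in\rho(A_B)}(A_B-\delta)^{-1}\mathrm{Ran}\,S_{\mu_0,B},\qquad \mathcal T=\mathcal T_B=\mathrm{Span}_{\mu\in\rho(A_B)}\mathrm{Ran}\,S_{\mu,B},$$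 and let $\widetilde{\mathcal S},\widetilde{\mathcal T}$ be the spaces obtained from these by exchanging $\phi$ and $\psi$ and replacing $B$ by $\overline B$ (with a base point $\tilde\mu_0$ in the corresponding resolvent set). Let $D(\lambda)=1+\int_{\mathbb R}\frac{\psi(x)\overline{\phi(x)}}{x-\lambda}dx$ for $\lambda\notin\mathbb R$, and for $f\in L^2(\mathbb R)$ and $w\in\mathbb C_+$ let $(P_+f)(w)=\frac1{2\pi i}\int_{\mathbb R}\frac{f(x)}{x-w}dx$ be the value at $w$ of the Riesz projection $P_+f\in H_2^+$. Let $z_1\in\mathbb C_-$, $w_1\in\mathbb C_+$, $\alpha\in\mathbb C$, $\psi(x)=\frac{\alpha}{x-z_1}$, $\overline{\phi(x)}=\frac1{x-w_1}$, and $$\lambda_0=z_1+\frac{2\pi i\alpha}{w_1-z_1},\qquad \widetilde\lambda_0=w_1+\frac{2\pi i\alpha}{w_1-z_1}.$$ Then $D(\lambda)=\frac{\lambda-\lambda_0}{\lambda-z_1}$ for $\lambda\in\mathbb C_+$ and $D(\lambda)=\frac{\lambda-\widetilde\lambda_0}{\lambda-w_1}$ for $\lambda\in\mathbb C_-$. Let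 $B\in\mathbb C\setminus\{\pi i,-\pi i\}$. Then the resolvent sets of $A_B$ and of its counterpart with $\phi,\psi$ exchanged and $\overline B$ in place of $B$ are non-empty, and for all base points $\mu_0,\tilde\mu_0$ in them: 1. $\overline{\mathcal S}=\overline{\mathcal T}$ and $\overline{\widetilde{\mathcal S}}=\overline{\widetilde{\mathcal T}}$. 2. $\mathcal S^\perp\neq\{0\}$ if and only if $\lambda_0\in\mathbb C_+$. 3. If $\lambda_0\in\mathbb C_+$, then $\mathcal S^\perp$ is one-dimensional and is spanned by the function $t\mapsto\frac1{(t-\overline{w_1})(t-\overline{\lambda_0})}$. Equivalently, $\overline{\mathcal S}=\{f\in L^2(\mathbb R):(P_+f)(w_1)=(P_+f)(\lambda_0)\}$ if $\lambda_0\ne w_1$, and $\overline{\mathcal S}=\{f\in L^2(\mathbb R):(P_+f)'(w_1)=0\}$ if $\lambda_0=w_1$. 4. $\widetilde{\mathcal S}^\perp\neq\{0\}$ if and only if $\widetilde\lambda_0\in\mathbb C_-$. If $\lambda_0\in\mathbb C_+$ then $\widetilde\lambda_0\in\mathbb C_+$; if $\widetilde\lambda_0\in\mathbb C_-$ then $\lambda_0\in\mathbb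 C_-$. At least one of $\overline{\mathcal S}$ and $\overline{\widetilde{\mathcal S}}$ is the whole space $L^2(\mathbb R)$. -/

import Mathlib

open MeasureTheory Filter Topology Complex
open scoped ComplexConjugate

namespace Friedrichs

/-- The Hilbert space `L²(ℝ)` of complex-valued functions. -/
abbrev L2 : Type := Lp ℂ 2 (volume : Measure ℝ)

/-- The relation `Γ₁ u = a`, i.e. `lim_{R → ∞} ∫_{-R}^R u(x) dx = a`. -/
def HasGamma1 (u : L2) (a : ℂ) : Prop :=
  Tendsto (fun R : ℝ => ∫ x in (-R)..R, u x) atTop (𝓝 a)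

/-- The relation `Γ₂ u = c_u = c`, i.e. `x u(x) - c · 1 ∈ L²(ℝ)`. -/
def HasGamma2 (u : L2) (c : ℂ) : Prop :=
  MemLp (fun x : ℝ => (x : ℂ) * u x - c) 2 volume

theorem intervalIntegrable (u : L2) (a b : ℝ) : IntervalIntegrable (fun x => u x) volume a b :=
  (((Lp.memLp u).locallyIntegrable (by norm_num)).integrableOn_isCompact
    isCompact_uIcc).intervalIntegrable

theorem HasGamma1.zero : HasGamma1 0 0 := by
  have h : (fun R : ℝ => ∫ x in (-R)..R, (0 : L2) x) = fun _ => (0 : ℂ) := by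
    funext R
    rw [intervalIntegral.integral_congr_ae (g := fun _ => (0 : ℂ)) ?_]
    · simp
    · filter_upwards [Lp.coeFn_zero ℂ 2 (volume : Measure ℝ)] with x hx _ using hx
  unfold HasGamma1
  rw [h]
  exact tendsto_const_nhds

theorem HasGamma1.add {u v : L2} {a b : ℂ} (hu : HasGamma1 u a) (hv : HasGamma1 v b) :
    HasGamma1 (u + v) (a + b) := by
  refine (Tendsto.add hu hv).congr fun R => ?_
  rw [← intervalIntegral.integral_add (intervalIntegrable u _ _) (intervalIntegrable v _ _)]
  refine intervalIntegral.integral_congr_ae ?_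
  filter_upwards [Lp.coeFn_add u v] with x hx _
  rw [hx]; rfl

theorem HasGamma1.smul {u : L2} {a : ℂ} (k : ℂ) (hu : HasGamma1 u a) :
    HasGamma1 (k • u) (k * a) := by
  refine (Tendsto.const_mul k hu).congr fun R => ?_
  rw [← intervalIntegral.integral_const_mul]
  refine intervalIntegral.integral_congr_ae ?_
  filter_upwards [Lp.coeFn_smul k u] with x hx _
  rw [hx]; rfl

theorem HasGamma2.zero : HasGamma2 0 0 := by
  refine (memLp_congr_ae ?_).2 (MemLp.zero (ε := ℂ) (p := 2) (μ := (volume : Measure ℝ)))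
  filter_upwards [Lp.coeFn_zero ℂ 2 (volume : Measure ℝ)] with x _
  simp

theorem HasGamma2.add {u v : L2} {c d : ℂ} (hu : HasGamma2 u c) (hv : HasGamma2 v d) :
    HasGamma2 (u + v) (c + d) := by
  refine (memLp_congr_ae ?_).2 (MemLp.add hu hv)
  filter_upwards [Lp.coeFn_add u v] with x hx
  simp only [hx, Pi.add_apply]
  ring

theorem HasGamma2.smul {u : L2} {c : ℂ} (k : ℂ) (hu : HasGamma2 u c) :
    HasGamma2 (k • u) (k * c) := by
  refine (memLp_congr_ae ?_).2 (MemLp.const_smul hu k)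
  filter_upwards [Lp.coeFn_smul k u] with x hx
  simp only [hx, Pi.smul_apply, smul_eq_mul]
  ring

/-- `{f ∈ L² : x f ∈ L², lim_{R → ∞} ∫_{-R}^R f = 0}`. -/
def minDomain : Submodule ℂ L2 where
  carrier := {f | MemLp (fun x : ℝ => (x : ℂ) * f x) 2 volume ∧
    Tendsto (fun R : ℝ => ∫ x in (-R)..R, f x) atTop (𝓝 0)}
  zero_mem' := ⟨by simpa only [HasGamma2, sub_zero] using HasGamma2.zero, HasGamma1.zero⟩
  add_mem' := by
    rintro f g ⟨hf, hf1⟩ ⟨hg, hg1⟩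
    refine ⟨?_, by simpa [HasGamma1] using HasGamma1.add hf1 hg1⟩
    have h := HasGamma2.add (u := f) (v := g) (c := 0) (d := 0)
      (by simpa [HasGamma2] using hf) (by simpa [HasGamma2] using hg)
    simpa [HasGamma2] using h
  smul_mem' := by
    rintro k f ⟨hf, hf1⟩
    refine ⟨?_, by simpa [HasGamma1] using HasGamma1.smul k hf1⟩
    have h := HasGamma2.smul (u := f) (c := 0) k (by simpa [HasGamma2] using hf)
    simpa [HasGamma2] using h

/-- The minimal operator `(A f)(x) = x f(x) + ⟨f, φ⟩ ψ(x)` on `minDomain`, where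
`⟨f, φ⟩ = ∫ f φ̄` is Mathlib's `inner ℂ φ f`. The operator `Ã` is `minOp ψ φ`. -/
noncomputable def minOp (φ ψ : L2) : L2 →ₗ.[ℂ] L2 where
  domain := minDomain
  toFun :=
    { toFun := fun f => f.2.1.toLp + inner ℂ φ (f : L2) • ψ
      map_add' := by
        intro f g
        have h : (f + g).2.1.toLp = f.2.1.toLp + g.2.1.toLp := by
          rw [← MemLp.toLp_add]
          refine MemLp.toLp_congr _ _ ?_
          filter_upwards [Lp.coeFn_add (f : L2) (g : L2)] with x hx
          simp only [Submodule.coe_add, hx, Pi.add_apply]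
          ring
        rw [h, Submodule.coe_add, inner_add_right, add_smul]
        abel
      map_smul' := by
        intro k f
        have h : (k • f).2.1.toLp = k • f.2.1.toLp := by
          rw [← MemLp.toLp_const_smul]
          refine MemLp.toLp_congr _ _ ?_
          filter_upwards [Lp.coeFn_smul k (f : L2)] with x hx
          simp only [Submodule.coe_smul, hx, Pi.smul_apply, smul_eq_mul]
          ring
        rw [h, Submodule.coe_smul, inner_smul_right, mul_smul, smul_add, RingHom.id_apply] }

/-- The maximal operator `Ã*`, the adjoint of `Ã`. -/
noncomputable def maxOp (φ ψ : L2) : L2 →ₗ.[ℂ] L2 := (minOp ψ φ).adjoint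

/-- The functions satisfying the boundary condition `Γ₁ u = B Γ₂ u`. -/
def boundaryCondition (B : ℂ) : Submodule ℂ L2 where
  carrier := {u | ∃ a c : ℂ, HasGamma1 u a ∧ HasGamma2 u c ∧ a = B * c}
  zero_mem' := ⟨0, 0, HasGamma1.zero, HasGamma2.zero, by simp⟩
  add_mem' := by
    rintro u v ⟨a, c, ha, hc, h⟩ ⟨a', c', ha', hc', h'⟩
    exact ⟨a + a', c + c', ha.add ha', hc.add hc', by rw [h, h']; ring⟩
  smul_mem' := by
    rintro k u ⟨a, c, ha, hc, h⟩
    exact ⟨k * a, k * c, ha.smul k, hc.smul k, by rw [h]; ring⟩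

/-- `A_B`, the restriction of `Ã*` to `ker (Γ₁ - B Γ₂)`. -/
noncomputable def opB (φ ψ : L2) (B : ℂ) : L2 →ₗ.[ℂ] L2 :=
  (maxOp φ ψ).domRestrict (boundaryCondition B)

/-- The resolvent set of an unbounded operator `T`: those `lam` for which `T - lam` has an
everywhere defined bounded two-sided inverse. -/
def resolvSet (T : L2 →ₗ.[ℂ] L2) : Set ℂ :=
  {lam | ∃ R : L2 →L[ℂ] L2,
    (∀ g : L2, ∃ f : T.domain, (f : L2) = R g ∧ T f - lam • (f : L2) = g) ∧
    ∀ f : T.domain, R (T f - lam • (f : L2)) = f}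

/-- The graph relation of the solution operator: `S_{lam,B} h = u` iff
`(Ã* - lam) u = 0` and `(Γ₁ - B Γ₂) u = h`. -/
def SolutionOp (φ ψ : L2) (B lam h : ℂ) (u : L2) : Prop :=
  (∃ v : (maxOp φ ψ).domain, (v : L2) = u ∧ maxOp φ ψ v - lam • (v : L2) = 0) ∧
    ∃ a c : ℂ, HasGamma1 u a ∧ HasGamma2 u c ∧ a - B * c = h

/-- The range of `S_{lam,B}`. -/
def ranSolutionOp (φ ψ : L2) (B lam : ℂ) : Set L2 := {u | ∃ h : ℂ, SolutionOp φ ψ B lam h u}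

/-- The closure of `𝒮_B = Span_{δ ∉ σ(A_B)} (A_B - δ)⁻¹ Ran S_{μ₀,B}`. -/
noncomputable def detectableS (φ ψ : L2) (B μ₀ : ℂ) : Submodule ℂ L2 :=
  (Submodule.span ℂ {u : L2 | ∃ δ ∈ resolvSet (opB φ ψ B), ∃ f : (opB φ ψ B).domain,
    (f : L2) = u ∧ opB φ ψ B f - δ • (f : L2) ∈ ranSolutionOp φ ψ B μ₀}).topologicalClosure

/-- The closure of `𝒯_B = Span_{μ ∉ σ(A_B)} Ran S_{μ,B}`. -/
noncomputable def detectableT (φ ψ : L2) (B : ℂ) : Submodule ℂ L2 :=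
  (Submodule.span ℂ
    {u : L2 | ∃ μ ∈ resolvSet (opB φ ψ B), u ∈ ranSolutionOp φ ψ B μ}).topologicalClosure

/-- `D(lam) = 1 + ∫ ψ(x) conj(φ(x)) / (x - lam) dx`. -/
noncomputable def D (φ ψ : L2) (lam : ℂ) : ℂ :=
  1 + ∫ x : ℝ, 1 / ((x : ℂ) - lam) * ψ x * conj (φ x)

/-- The value at a point `w` of the upper half-plane of the Hardy function `P₊ f ∈ H₂⁺`, i.e. of
the holomorphic function with boundary values `lim_{ε → 0} (2πi)⁻¹ ∫ f(x) / (x - (k + iε)) dx`. -/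
noncomputable def rieszPlus (f : L2) (w : ℂ) : ℂ :=
  1 / (2 * Real.pi * I) * ∫ x : ℝ, f x / ((x : ℂ) - w)

end Friedrichs

namespace Friedrichs

open scoped BoundedContinuousFunction

/-! ### Multiplication operators and the Cauchy kernel -/

/-! For non-real `l`, dividing by `x - l` turns `(Ã* - l) u = g` with `Γ₂ u = c` into `u = res l g +
c • ker l - ⟨u, φ⟩ • res l ψ`. Applying `⟨·, φ⟩` and the boundary condition leaves a 2×2 linear
system for `⟨u, φ⟩` and `c`. For the rational data one off-diagonal entry vanishes in each
half-plane, because `φ̄` and `ψ` have their poles on opposite sides of the line. The determinant is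
then `D(l) (B - Γ₁ (ker l))`, where `Γ₁ (ker l) = ±πi`. Hence every non-real `l` outside a finite
set is in the resolvent set, and the solutions of the homogeneous equation are the multiples of
`solKer φ ψ l`.

Both detectable spaces have the closed span of these vectors as closure (`detectableT_eq_solSpan`,
`detectableS_le_solSpan`, `solSpan_le_detectableS`). Finitely many omitted points do not matter, by
continuity of the resolvent. The differences `S_{l,B} h - S_{μ₀,B} h` lie in the span defining `𝒮`,
and `S_{l,B} h → 0` along `l = it`, so `S_{μ₀,B} h` itself is in the closure.

For `g` orthogonal to this span put `G(l) = ⟨ker l, g⟩`, the Cauchy transform of `ḡ`. Then `G = 0`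
on the upper half-plane, while `(l - w)(l - l₀) G(l)` is constant on the lower one
(`mem_orthogonal_solSpan_iff`). If `l₀` is not in the open upper half-plane, a non-zero constant
would force a simple pole, faster than the growth `|Im l|^(-1/2)` of a Cauchy transform
(`eq_zero_of_pole`); so `G = 0`, and `g = 0` because Cauchy kernels are total (`eq_top_of_ker_mem`).
If `Im l₀ > 0`, the function `1/((x - w̄)(x - l̄₀))` realises the constant, and uniquely up to
scaling (`orthogonal_solSpan_eq_span`).

The exchanged problem is the same one after complex conjugation: `(w, z, l₀, lt₀)` becomes `(z̄, w̄,
conj lt₀, conj l₀)`. -/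

theorem memLp_mul (q : ℝ →ᵇ ℂ) (g : L2) : MemLp (fun x => q x * g x) 2 volume :=
  (Lp.memLp g).of_le_mul (c := ‖q‖)
    (q.continuous.aestronglyMeasurable.mul (Lp.aestronglyMeasurable g))
    (Eventually.of_forall fun x => by
      rw [norm_mul]
      exact mul_le_mul_of_nonneg_right (q.norm_coe_le_norm x) (norm_nonneg _))

/-- Multiplication by a bounded continuous function on `L²(ℝ)`. -/
noncomputable def mulOp (q : ℝ →ᵇ ℂ) : L2 →L[ℂ] L2 :=
  LinearMap.mkContinuous
    { toFun := fun g => (memLp_mul q g).toLp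
      map_add' := by
        intro f g
        rw [← MemLp.toLp_add]
        refine MemLp.toLp_congr _ _ ?_
        filter_upwards [Lp.coeFn_add f g] with x hx
        simp only [hx, Pi.add_apply]
        ring
      map_smul' := by
        intro k f
        rw [RingHom.id_apply, ← MemLp.toLp_const_smul]
        refine MemLp.toLp_congr _ _ ?_
        filter_upwards [Lp.coeFn_smul k f] with x hx
        simp only [hx, Pi.smul_apply, smul_eq_mul]
        ring } ‖q‖ (by
      intro g
      refine Lp.norm_le_mul_norm_of_ae_le_mul ?_
      filter_upwards [(memLp_mul q g).coeFn_toLp] with x hx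
      simp only [LinearMap.coe_mk, AddHom.coe_mk, hx, norm_mul]
      exact mul_le_mul_of_nonneg_right (q.norm_coe_le_norm x) (norm_nonneg _))

theorem coeFn_mulOp (q : ℝ →ᵇ ℂ) (g : L2) : mulOp q g =ᵐ[volume] fun x => q x * g x :=
  (memLp_mul q g).coeFn_toLp

theorem norm_mulOp_apply_le (q : ℝ →ᵇ ℂ) (g : L2) : ‖mulOp q g‖ ≤ ‖q‖ * ‖g‖ :=
  ((mulOp q).le_opNorm g).trans
    (mul_le_mul_of_nonneg_right (LinearMap.mkContinuous_norm_le _ (norm_nonneg _) _)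
      (norm_nonneg _))

theorem ofReal_sub_ne_zero {l : ℂ} (hl : l.im ≠ 0) (x : ℝ) : (x : ℂ) - l ≠ 0 := by
  intro h
  apply hl
  have := congrArg Complex.im h
  simpa using this

theorem abs_im_le_norm_sub (l : ℂ) (x : ℝ) : |l.im| ≤ ‖(x : ℂ) - l‖ := by
  simpa using Complex.abs_im_le_norm ((x : ℂ) - l)

theorem norm_cauchy_le {l : ℂ} (hl : l.im ≠ 0) (x : ℝ) : ‖1 / ((x : ℂ) - l)‖ ≤ |l.im|⁻¹ := by
  rw [norm_div, norm_one, one_div]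
  exact inv_anti₀ (abs_pos.2 hl) (abs_im_le_norm_sub l x)

theorem continuous_cauchy {l : ℂ} (hl : l.im ≠ 0) :
    Continuous fun x : ℝ => 1 / ((x : ℂ) - l) :=
  continuous_const.div (continuous_ofReal.sub continuous_const) (ofReal_sub_ne_zero hl)

/-- `x ↦ (x - l)⁻¹` as a bounded continuous function (zero for real `l`). -/
noncomputable def cauchy (l : ℂ) : ℝ →ᵇ ℂ :=
  if hl : l.im = 0 then 0 else
    BoundedContinuousFunction.ofNormedAddCommGroup (fun x : ℝ => 1 / ((x : ℂ) - l))
      (continuous_cauchy hl) (|l.im|⁻¹) (norm_cauchy_le hl)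

theorem cauchy_apply {l : ℂ} (hl : l.im ≠ 0) (x : ℝ) : cauchy l x = 1 / ((x : ℂ) - l) := by
  simp [cauchy, hl]

theorem norm_cauchy {l : ℂ} (hl : l.im ≠ 0) : ‖cauchy l‖ ≤ |l.im|⁻¹ :=
  (BoundedContinuousFunction.norm_le (by positivity)).2 fun x => by
    rw [cauchy_apply hl]
    exact norm_cauchy_le hl x

theorem memLp_cauchy {l : ℂ} (hl : l.im ≠ 0) : MemLp (cauchy l) 2 (volume : Measure ℝ) := by
  rw [memLp_two_iff_integrable_sq_norm (cauchy l).continuous.aestronglyMeasurable]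
  have h := ((integrable_inv_one_add_sq.comp_sub_right (l.re / |l.im|)).comp_mul_left'
    (R := |l.im|⁻¹) (by positivity)).const_mul (|l.im|⁻¹ ^ 2)
  refine h.congr (Eventually.of_forall fun x => ?_)
  have hl' : |l.im| ≠ 0 := abs_ne_zero.2 hl
  have h1 : ‖(x : ℂ) - l‖ ^ 2 = (x - l.re) ^ 2 + |l.im| ^ 2 := by
    rw [Complex.sq_norm, Complex.normSq_apply, sq_abs]
    simp
    ring
  simp only [cauchy_apply hl, norm_div, norm_one, div_pow, h1, one_pow]
  have h2 : |l.im| ^ 2 + (x - l.re) ^ 2 ≠ 0 := by positivity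
  have h3 : (x - l.re) ^ 2 + |l.im| ^ 2 ≠ 0 := by positivity
  have h4 : 1 + (|l.im|⁻¹ * x - l.re / |l.im|) ^ 2
      = ((x - l.re) ^ 2 + |l.im| ^ 2) * (|l.im|⁻¹ ^ 2) := by
    field_simp
    ring
  rw [h4]
  field_simp

/-- `x ↦ (x - l)⁻¹` as an element of `L²(ℝ)` (zero for real `l`). -/
noncomputable def ker (l : ℂ) : L2 :=
  if hl : l.im = 0 then 0 else (memLp_cauchy hl).toLp

theorem coeFn_ker {l : ℂ} (hl : l.im ≠ 0) :
    ker l =ᵐ[volume] fun x : ℝ => 1 / ((x : ℂ) - l) := by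
  rw [ker, dif_neg hl]
  filter_upwards [(memLp_cauchy hl).coeFn_toLp] with x hx
  rw [hx, cauchy_apply hl]

/-- Multiplication by `(x - l)⁻¹` on `L²(ℝ)`. -/
noncomputable def res (l : ℂ) : L2 →L[ℂ] L2 := mulOp (cauchy l)

theorem coeFn_res {l : ℂ} (hl : l.im ≠ 0) (g : L2) :
    res l g =ᵐ[volume] fun x : ℝ => 1 / ((x : ℂ) - l) * g x := by
  filter_upwards [coeFn_mulOp (cauchy l) g] with x hx
  rw [res, hx, cauchy_apply hl]

theorem norm_res_apply_le {l : ℂ} (hl : l.im ≠ 0) (g : L2) : ‖res l g‖ ≤ |l.im|⁻¹ * ‖g‖ :=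
  (norm_mulOp_apply_le _ _).trans (mul_le_mul_of_nonneg_right (norm_cauchy hl) (norm_nonneg _))

theorem ker_sub_ker {l m : ℂ} (hl : l.im ≠ 0) (hm : m.im ≠ 0) :
    ker l - ker m = (l - m) • res l (ker m) := by
  refine Lp.ext ?_
  filter_upwards [Lp.coeFn_sub (ker l) (ker m), Lp.coeFn_smul (l - m) (res l (ker m)),
    coeFn_ker hl, coeFn_ker hm, coeFn_res hl (ker m)] with x h1 h2 h3 h4 h5
  rw [h1, h2, Pi.sub_apply, Pi.smul_apply, h5, h3, h4, smul_eq_mul]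
  have := ofReal_sub_ne_zero hl x
  have := ofReal_sub_ne_zero hm x
  field_simp
  ring

theorem res_sub_res {l m : ℂ} (hl : l.im ≠ 0) (hm : m.im ≠ 0) (g : L2) :
    res l g - res m g = (l - m) • res l (res m g) := by
  refine Lp.ext ?_
  filter_upwards [Lp.coeFn_sub (res l g) (res m g), Lp.coeFn_smul (l - m) (res l (res m g)),
    coeFn_res hl g, coeFn_res hm g, coeFn_res hl (res m g)] with x h1 h2 h3 h4 h5
  rw [h1, h2, Pi.sub_apply, Pi.smul_apply, h5, h3, h4, smul_eq_mul]
  have := ofReal_sub_ne_zero hl x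
  have := ofReal_sub_ne_zero hm x
  field_simp
  ring

/-- The factor `l - m` tends to zero while `‖res l v‖ ≤ |Im l|⁻¹ ‖v‖` stays bounded near `m`. This
serves both the kernels and the multiplication operators. -/
theorem tendsto_of_sub_eq_smul_res {F : ℂ → L2} {m : ℂ} (hm : m.im ≠ 0) (v : L2)
    (h : ∀ l : ℂ, l.im ≠ 0 → F l - F m = (l - m) • res l v) : Tendsto F (𝓝 m) (𝓝 (F m)) := by
  rw [tendsto_iff_norm_sub_tendsto_zero]
  have h1 : Tendsto (fun l : ℂ => ‖l - m‖ * (|l.im|⁻¹ * ‖v‖)) (𝓝 m)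
      (𝓝 (‖m - m‖ * (|m.im|⁻¹ * ‖v‖))) := by
    have : ContinuousAt (fun l : ℂ => |l.im|⁻¹) m :=
      (continuous_im.abs.continuousAt).inv₀ (abs_ne_zero.2 hm)
    exact ((continuous_id.sub continuous_const).norm.continuousAt.tendsto).mul
      (this.tendsto.mul_const _)
  rw [sub_self, norm_zero, zero_mul] at h1
  have h2 : ∀ᶠ l : ℂ in 𝓝 m, l.im ≠ 0 := continuous_im.continuousAt.eventually_ne hm
  refine squeeze_zero' (Eventually.of_forall fun _ => norm_nonneg _) ?_ h1
  filter_upwards [h2] with l hl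
  rw [h l hl, norm_smul]
  exact mul_le_mul_of_nonneg_left (norm_res_apply_le hl v) (norm_nonneg _)

theorem tendsto_ker {m : ℂ} (hm : m.im ≠ 0) : Tendsto ker (𝓝 m) (𝓝 (ker m)) :=
  tendsto_of_sub_eq_smul_res hm (ker m) fun _ hl => ker_sub_ker hl hm

theorem tendsto_res {m : ℂ} (hm : m.im ≠ 0) (g : L2) :
    Tendsto (fun l => res l g) (𝓝 m) (𝓝 (res m g)) :=
  tendsto_of_sub_eq_smul_res (F := fun l => res l g) hm (res m g) fun _ hl => res_sub_res hl hm g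

theorem res_ker {l m : ℂ} (hl : l.im ≠ 0) (hm : m.im ≠ 0) (h : l ≠ m) :
    res l (ker m) = (l - m)⁻¹ • (ker l - ker m) := by
  rw [ker_sub_ker hl hm, smul_smul, inv_mul_cancel₀ (sub_ne_zero.2 h), one_smul]

/-! ### The Cauchy kernels are total in `L²(ℝ)` -/

/-- The extension of `x ↦ (x - i)⁻¹` to the one-point compactification of `ℝ`. -/
noncomputable def cauchyInfty : C(OnePoint ℝ, ℂ) :=
  OnePoint.continuousMapMk ⟨fun x : ℝ => 1 / ((x : ℂ) - I), continuous_cauchy (by simp)⟩ 0 (by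
    rw [coclosedCompact_eq_cocompact]
    have h : Tendsto (fun x : ℝ => ‖(x : ℂ) - I‖) (cocompact ℝ) atTop := by
      refine tendsto_atTop_mono (f := fun x : ℝ => ‖x‖ - 1) (fun x => ?_)
        (tendsto_atTop_add_const_right _ _ tendsto_norm_cocompact_atTop)
      have := norm_sub_norm_le (x : ℂ) I
      simpa using this
    rw [tendsto_zero_iff_norm_tendsto_zero]
    refine h.inv_tendsto_atTop.congr fun x => ?_
    simp)

theorem cauchyInfty_coe (x : ℝ) : cauchyInfty (x : OnePoint ℝ) = 1 / ((x : ℂ) - I) := rfl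

/-- Injectivity lets this single function separate points, as Stone–Weierstrass requires. -/
theorem cauchyInfty_injective : Function.Injective cauchyInfty := by
  have h0 : ∀ x : ℝ, (x : ℂ) - I ≠ 0 := ofReal_sub_ne_zero (by simp)
  have h1 : ∀ x : ℝ, cauchyInfty (x : OnePoint ℝ) ≠ cauchyInfty OnePoint.infty := fun x => by
    rw [cauchyInfty_coe]
    exact one_div_ne_zero (h0 x)
  intro x y hxy
  induction x using OnePoint.rec with
  | infty =>
    induction y using OnePoint.rec with
    | infty => rfl
    | coe y => exact absurd hxy.symm (h1 y)
  | coe x =>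
    induction y using OnePoint.rec with
    | infty => exact absurd hxy (h1 x)
    | coe y =>
      rw [cauchyInfty_coe, cauchyInfty_coe, one_div, one_div, inv_inj, sub_left_inj,
        ofReal_inj] at hxy
      rw [hxy]

/-- Restriction of a continuous function on the one-point compactification to `ℝ`. -/
noncomputable def restr (p : C(OnePoint ℝ, ℂ)) : ℝ →ᵇ ℂ :=
  (BoundedContinuousFunction.mkOfCompact p).compContinuous
    ⟨((↑) : ℝ → OnePoint ℝ), OnePoint.continuous_coe⟩

theorem restr_apply (p : C(OnePoint ℝ, ℂ)) (x : ℝ) : restr p x = p x := rfl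

theorem norm_restr_le (p : C(OnePoint ℝ, ℂ)) : ‖restr p‖ ≤ ‖p‖ :=
  (BoundedContinuousFunction.norm_le (norm_nonneg _)).2 fun _ => p.norm_coe_le_norm _

/-- The closed linear span of the Cauchy kernels. -/
noncomputable def kerSpan : Submodule ℂ L2 :=
  (Submodule.span ℂ (Set.range ker)).topologicalClosure

theorem isClosed_kerSpan : IsClosed (kerSpan : Set L2) :=
  Submodule.isClosed_topologicalClosure _

theorem ker_mem_kerSpan (l : ℂ) : ker l ∈ kerSpan :=
  Submodule.le_topologicalClosure _ (Submodule.subset_span ⟨l, rfl⟩)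

theorem res_mem_kerSpan {m : ℂ} (hm : m.im ≠ 0) {g : L2} (hg : g ∈ kerSpan) :
    res m g ∈ kerSpan := by
  have h1 : ∀ l : ℂ, l ≠ m → res m (ker l) ∈ kerSpan := by
    intro l hlm
    by_cases hl : l.im = 0
    · simp [ker, hl]
    · rw [res_ker hm hl hlm.symm]
      exact kerSpan.smul_mem _ (kerSpan.sub_mem (ker_mem_kerSpan _) (ker_mem_kerSpan _))
  have h2 : ∀ l : ℂ, res m (ker l) ∈ kerSpan := by
    intro l
    by_cases hlm : l = m
    · subst hlm
      -- The partial fraction formula fails at a double pole, which is reached as a limit of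
      -- distinct poles.
      have h3 : Tendsto (fun k => res l (ker k)) (𝓝[≠] l) (𝓝 (res l (ker l))) :=
        (((res l).continuous.tendsto _).comp (tendsto_ker hm)).mono_left nhdsWithin_le_nhds
      exact isClosed_kerSpan.mem_of_tendsto h3
        (eventually_mem_nhdsWithin.mono fun k hk => h1 k hk)
    · exact h1 l hlm
  have h3 : kerSpan ≤ kerSpan.comap (res m).toLinearMap := by
    refine Submodule.topologicalClosure_minimal _ ?_
      (isClosed_kerSpan.preimage (res m).continuous)
    rw [Submodule.span_le]
    rintro _ ⟨l, rfl⟩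
    exact h2 l
  exact h3 hg

/-- Partial fractions make the closed span invariant under multiplication by `1/(x - i)` and its
conjugate `1/(x + i)`. By Stone–Weierstrass on the compactified line these generate a dense
subalgebra, and invariance passes to uniform limits. -/
theorem mulOp_restr_mem_kerSpan (p : C(OnePoint ℝ, ℂ)) {g : L2} (hg : g ∈ kerSpan) :
    mulOp (restr p) g ∈ kerSpan := by
  have key : ∀ q ∈ StarAlgebra.adjoin ℂ ({cauchyInfty} : Set C(OnePoint ℝ, ℂ)),
      ∀ g ∈ kerSpan, mulOp (restr q) g ∈ kerSpan := by
    intro q hq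
    rw [← StarSubalgebra.mem_toSubalgebra, StarAlgebra.adjoin_toSubalgebra] at hq
    induction hq using Algebra.adjoin_induction with
    | mem q hq =>
      intro g hg
      rcases hq with hq | hq
      · rw [Set.mem_singleton_iff.1 hq]
        have : restr cauchyInfty = cauchy I := by
          ext x
          rw [restr_apply, cauchyInfty_coe, cauchy_apply (by simp)]
        rw [this]
        exact res_mem_kerSpan (by simp) hg
      · rw [← star_star q, Set.mem_singleton_iff.1 (Set.mem_star.1 hq)]
        have : restr (star cauchyInfty) = cauchy (-I) := by
          ext x
          rw [restr_apply, ContinuousMap.star_apply, cauchyInfty_coe, cauchy_apply (by simp)]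
          simp
        rw [this]
        exact res_mem_kerSpan (by simp) hg
    | algebraMap c =>
      intro g hg
      have : mulOp (restr (algebraMap ℂ C(OnePoint ℝ, ℂ) c)) g = c • g := by
        refine Lp.ext ?_
        filter_upwards [coeFn_mulOp (restr (algebraMap ℂ C(OnePoint ℝ, ℂ) c)) g,
          Lp.coeFn_smul c g] with x h1 h2
        rw [h1, h2, restr_apply, Pi.smul_apply, smul_eq_mul]
        rfl
      rw [this]
      exact kerSpan.smul_mem _ hg
    | add a b _ _ ha hb =>
      intro g hg
      have : mulOp (restr (a + b)) g = mulOp (restr a) g + mulOp (restr b) g := by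
        refine Lp.ext ?_
        filter_upwards [coeFn_mulOp (restr (a + b)) g, coeFn_mulOp (restr a) g,
          coeFn_mulOp (restr b) g, Lp.coeFn_add (mulOp (restr a) g) (mulOp (restr b) g)]
          with x h1 h2 h3 h4
        rw [h1, h4, Pi.add_apply, h2, h3]
        simp only [restr_apply, ContinuousMap.add_apply]
        ring
      rw [this]
      exact kerSpan.add_mem (ha g hg) (hb g hg)
    | mul a b _ _ ha hb =>
      intro g hg
      have : mulOp (restr (a * b)) g = mulOp (restr a) (mulOp (restr b) g) := by
        refine Lp.ext ?_
        filter_upwards [coeFn_mulOp (restr (a * b)) g, coeFn_mulOp (restr b) g,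
          coeFn_mulOp (restr a) (mulOp (restr b) g)] with x h1 h2 h3
        rw [h1, h3, h2]
        simp only [restr_apply, ContinuousMap.mul_apply]
        ring
      rw [this]
      exact ha _ (hb g hg)
  have hsep : (StarAlgebra.adjoin ℂ ({cauchyInfty} : Set C(OnePoint ℝ, ℂ))).SeparatesPoints := by
    intro x y hxy
    exact ⟨cauchyInfty, ⟨cauchyInfty, StarAlgebra.self_mem_adjoin_singleton ℂ _, rfl⟩,
      fun h => hxy (cauchyInfty_injective h)⟩
  have hp : p ∈ closure
      (StarAlgebra.adjoin ℂ ({cauchyInfty} : Set C(OnePoint ℝ, ℂ)) : Set C(OnePoint ℝ, ℂ)) := by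
    rw [← StarSubalgebra.topologicalClosure_coe,
      ContinuousMap.starSubalgebra_topologicalClosure_eq_top_of_separatesPoints _ hsep]
    trivial
  refine isClosed_kerSpan.closure_subset_iff.2 subset_rfl (Metric.mem_closure_iff.2 fun ε hε => ?_)
  obtain ⟨q, hq, hpq⟩ := Metric.mem_closure_iff.1 hp (ε / (‖g‖ + 1)) (by positivity)
  refine ⟨mulOp (restr q) g, key q hq g hg, ?_⟩
  have h1 : mulOp (restr p) g - mulOp (restr q) g = mulOp (restr (p - q)) g := by
    refine Lp.ext ?_
    filter_upwards [coeFn_mulOp (restr (p - q)) g, coeFn_mulOp (restr p) g,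
      coeFn_mulOp (restr q) g, Lp.coeFn_sub (mulOp (restr p) g) (mulOp (restr q) g)]
      with x h1 h2 h3 h4
    rw [h1, h4, Pi.sub_apply, h2, h3]
    simp only [restr_apply, ContinuousMap.sub_apply]
    ring
  rw [dist_eq_norm, h1]
  rw [dist_eq_norm, lt_div_iff₀ (by positivity)] at hpq
  calc ‖mulOp (restr (p - q)) g‖ ≤ ‖restr (p - q)‖ * ‖g‖ := norm_mulOp_apply_le _ _
    _ ≤ ‖p - q‖ * (‖g‖ + 1) := by
      gcongr
      · exact norm_restr_le _
      · linarith
    _ < ε := hpq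

theorem kerSpan_eq_top : kerSpan = ⊤ := by
  refine eq_top_iff.2 fun f _ => ?_
  refine isClosed_kerSpan.closure_subset_iff.2 subset_rfl (Metric.mem_closure_iff.2 fun ε hε => ?_)
  obtain ⟨g, hgs, hfg, hgc, hg⟩ := (Lp.memLp f).exists_hasCompactSupport_eLpNorm_sub_le
    (by norm_num) (ε := ENNReal.ofReal (ε / 2)) (by simpa using hε)
  refine ⟨hg.toLp, ?_, ?_⟩
  -- A compactly supported continuous `g` equals `((x - i) g) · 1/(x - i)`, and the first factor
  -- extends continuously by zero at infinity.
  · have hs : HasCompactSupport fun x : ℝ => ((x : ℂ) - I) * g x := hgs.mul_left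
    let p : C(OnePoint ℝ, ℂ) := OnePoint.continuousMapMk
      ⟨fun x : ℝ => ((x : ℂ) - I) * g x, (continuous_ofReal.sub continuous_const).mul hgc⟩ 0 (by
        rw [coclosedCompact_eq_cocompact]
        exact hs.is_zero_at_infty)
    have : hg.toLp = mulOp (restr p) (ker I) := by
      refine Lp.ext ?_
      filter_upwards [hg.coeFn_toLp, coeFn_mulOp (restr p) (ker I), coeFn_ker (l := I) (by simp)]
        with x h1 h2 h3
      rw [h1, h2, h3]
      change g x = (((x : ℂ) - I) * g x) * _
      have := ofReal_sub_ne_zero (l := I) (by simp) x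
      field_simp
    rw [this]
    exact mulOp_restr_mem_kerSpan p (ker_mem_kerSpan I)
  · have h1 : f - hg.toLp = ((Lp.memLp f).sub hg).toLp := by
      rw [MemLp.toLp_sub (Lp.memLp f) hg, Lp.toLp_coeFn]
    rw [dist_eq_norm, h1, Lp.norm_toLp]
    calc (eLpNorm (⇑f - g) 2 volume).toReal ≤ (ENNReal.ofReal (ε / 2)).toReal :=
          ENNReal.toReal_mono ENNReal.ofReal_ne_top hfg
      _ = ε / 2 := ENNReal.toReal_ofReal (by positivity)
      _ < ε := by linarith

/-- A closed subspace containing the Cauchy kernels `(x - l)⁻¹` for a dense set of `l` is the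
whole space. -/
theorem eq_top_of_ker_mem {W : Submodule ℂ L2} (hW : IsClosed (W : Set L2)) {S : Set ℂ}
    (hS : Dense S) (h : ∀ l ∈ S, ker l ∈ W) : W = ⊤ := by
  rw [eq_top_iff, ← kerSpan_eq_top]
  refine Submodule.topologicalClosure_minimal _ (Submodule.span_le.2 ?_) hW
  rintro _ ⟨l, rfl⟩
  by_cases hl : l.im = 0
  · simp [ker, hl]
  · have : (𝓝[S] l).NeBot := mem_closure_iff_nhdsWithin_neBot.1 (hS l)
    exact hW.mem_of_tendsto ((tendsto_ker hl).mono_left nhdsWithin_le_nhds)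
      (eventually_mem_nhdsWithin.mono h)

/-! ### Boundary values and inner products of the Cauchy kernels -/

theorem HasGamma1.unique {u : L2} {a b : ℂ} (ha : HasGamma1 u a) (hb : HasGamma1 u b) : a = b :=
  tendsto_nhds_unique ha hb

theorem HasGamma2.unique {u : L2} {a b : ℂ} (ha : HasGamma2 u a) (hb : HasGamma2 u b) :
    a = b := by
  have h : MemLp (fun _ : ℝ => b - a) 2 (volume : Measure ℝ) := by
    convert MemLp.sub ha hb using 1
    funext x
    simp
  rw [memLp_const_iff (by norm_num) (by norm_num)] at h
  rcases h with h | h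
  · exact (sub_eq_zero.1 h).symm
  · simp at h

theorem HasGamma1.congr {u : L2} {a b : ℂ} (h : HasGamma1 u a) (hab : a = b) : HasGamma1 u b :=
  hab ▸ h

theorem HasGamma2.congr {u : L2} {a b : ℂ} (h : HasGamma2 u a) (hab : a = b) : HasGamma2 u b :=
  hab ▸ h

theorem HasGamma1.sub {u v : L2} {a b : ℂ} (hu : HasGamma1 u a) (hv : HasGamma1 v b) :
    HasGamma1 (u - v) (a - b) := by
  have := hu.add (hv.smul (-1))
  rw [neg_one_smul, ← sub_eq_add_neg] at this
  exact this.congr (by ring)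

theorem inner_L2_eq (f g : L2) : inner ℂ f g = ∫ x, conj (f x) * g x := by
  rw [L2.inner_def]
  refine integral_congr_ae (Eventually.of_forall fun x => ?_)
  simp only [RCLike.inner_apply]
  ring

theorem conj_im_ne_zero {l : ℂ} (hl : l.im ≠ 0) : (conj l).im ≠ 0 := by simpa using hl

theorem inner_ker_conj {l : ℂ} (hl : l.im ≠ 0) (g : L2) :
    inner ℂ (ker (conj l)) g = ∫ x : ℝ, 1 / ((x : ℂ) - l) * g x := by
  rw [inner_L2_eq]
  refine integral_congr_ae ?_
  filter_upwards [coeFn_ker (conj_im_ne_zero hl)] with x hx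
  rw [hx]
  simp

theorem integrable_cauchy_mul {l : ℂ} (hl : l.im ≠ 0) (g : L2) :
    Integrable fun x : ℝ => 1 / ((x : ℂ) - l) * g x := by
  refine (L2.integrable_inner (𝕜 := ℂ) (ker (conj l)) g).congr ?_
  filter_upwards [coeFn_ker (conj_im_ne_zero hl)] with x hx
  rw [hx, RCLike.inner_apply]
  simp [mul_comm]

theorem hasGamma1_res {l : ℂ} (hl : l.im ≠ 0) (g : L2) :
    HasGamma1 (res l g) (inner ℂ (ker (conj l)) g) := by
  rw [inner_ker_conj hl]
  have h := intervalIntegral_tendsto_integral (integrable_cauchy_mul hl g)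
    tendsto_neg_atTop_atBot tendsto_id
  refine h.congr fun R => intervalIntegral.integral_congr_ae ?_
  filter_upwards [coeFn_res hl g] with x hx _
  rw [hx]

theorem hasGamma2_res {l : ℂ} (hl : l.im ≠ 0) (g : L2) : HasGamma2 (res l g) 0 := by
  have h : MemLp (fun x => (g + l • res l g) x) 2 (volume : Measure ℝ) := Lp.memLp _
  refine (memLp_congr_ae ?_).1 h
  filter_upwards [coeFn_res hl g, Lp.coeFn_add g (l • res l g), Lp.coeFn_smul l (res l g)]
    with x h1 h2 h3
  have := ofReal_sub_ne_zero hl x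
  rw [h2, Pi.add_apply, h3, Pi.smul_apply, h1, smul_eq_mul]
  field_simp
  ring

theorem hasGamma2_ker {l : ℂ} (hl : l.im ≠ 0) : HasGamma2 (ker l) 1 := by
  have h : MemLp (fun x => (l • ker l) x) 2 (volume : Measure ℝ) := Lp.memLp _
  refine (memLp_congr_ae ?_).1 h
  filter_upwards [coeFn_ker hl, Lp.coeFn_smul l (ker l)] with x h1 h2
  have := ofReal_sub_ne_zero hl x
  rw [h2, Pi.smul_apply, h1, smul_eq_mul]
  field_simp
  ring

/-- Rotation by `c = ±i` moves the line `x - l` into the right half-plane, away from the branch cut,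
so `log (c (x - l))` is a primitive. At `±R` the real terms `log R` cancel. -/
theorem hasGamma1_ker_of_rotation {c l : ℂ} (hc : c.re = 0) (h1 : c ∈ slitPlane)
    (h2 : -c ∈ slitPlane) (hl : l.im ≠ 0) (hre : 0 < (-(c * l)).re) :
    HasGamma1 (ker l) (log c - log (-c)) := by
  have hc0 : c ≠ 0 := slitPlane_ne_zero h1
  have hmem : ∀ x : ℝ, c * ((x : ℂ) - l) ∈ slitPlane := fun x => by
    refine mem_slitPlane_iff.2 (Or.inl ?_)
    have : (c * ((x : ℂ) - l)).re = (-(c * l)).re := by simp [hc]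
    rw [this]
    exact hre
  have hint : ∀ R : ℝ, ∫ x in (-R)..R, ker l x
      = log (c * ((R : ℂ) - l)) - log (c * (((-R : ℝ) : ℂ) - l)) := fun R => by
    rw [intervalIntegral.integral_congr_ae (g := fun x : ℝ => 1 / ((x : ℂ) - l))
      (by filter_upwards [coeFn_ker hl] with x hx _ using hx)]
    refine intervalIntegral.integral_eq_sub_of_hasDerivAt
      (f := fun x : ℝ => log (c * ((x : ℂ) - l))) (fun x _ => ?_)
      ((continuous_cauchy hl).intervalIntegrable _ _)
    have hd : HasDerivAt (fun x : ℝ => c * ((x : ℂ) - l)) (c * 1) x :=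
      ((hasDerivAt_id x).ofReal_comp.sub_const l).const_mul c
    have := hd.clog_real (hmem x)
    rw [mul_div_mul_left _ _ hc0] at this
    exact this
  have hlim : Tendsto (fun R : ℝ => c * l * (R : ℂ)⁻¹) atTop (𝓝 0) := by
    have : Tendsto (fun R : ℝ => ((R⁻¹ : ℝ) : ℂ)) atTop (𝓝 ((0 : ℝ) : ℂ)) :=
      (continuous_ofReal.tendsto 0).comp tendsto_inv_atTop_zero
    simpa using this.const_mul (c * l)
  have ht1 : Tendsto (fun R : ℝ => log (c - c * l * (R : ℂ)⁻¹)) atTop (𝓝 (log c)) := by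
    refine Tendsto.clog ?_ h1
    simpa using tendsto_const_nhds.sub hlim
  have ht2 : Tendsto (fun R : ℝ => log (-c - c * l * (R : ℂ)⁻¹)) atTop (𝓝 (log (-c))) := by
    refine Tendsto.clog ?_ h2
    simpa using tendsto_const_nhds.sub hlim
  refine (ht1.sub ht2).congr' ?_
  filter_upwards [eventually_gt_atTop 0] with R hR
  have hR0 : (R : ℂ) ≠ 0 := ofReal_ne_zero.2 hR.ne'
  have e1 : c * ((R : ℂ) - l) = (R : ℂ) * (c - c * l * (R : ℂ)⁻¹) := by
    field_simp
  have e2 : c * (((-R : ℝ) : ℂ) - l) = (R : ℂ) * (-c - c * l * (R : ℂ)⁻¹) := by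
    push_cast
    field_simp
  have n1 := slitPlane_ne_zero (hmem R)
  have n2 := slitPlane_ne_zero (hmem (-R))
  rw [e1] at n1
  rw [e2] at n2
  rw [hint, e1, e2, log_ofReal_mul hR (right_ne_zero_of_mul n1),
    log_ofReal_mul hR (right_ne_zero_of_mul n2)]
  ring

/-- The value of `Γ₁` on `(x - l)⁻¹`. -/
noncomputable def sgnPi (l : ℂ) : ℂ := if 0 < l.im then Real.pi * I else -(Real.pi * I)

theorem sgnPi_of_pos {l : ℂ} (h : 0 < l.im) : sgnPi l = Real.pi * I := if_pos h

theorem sgnPi_of_neg {l : ℂ} (h : l.im < 0) : sgnPi l = -(Real.pi * I) := if_neg h.not_gt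

theorem hasGamma1_ker {l : ℂ} (hl : l.im ≠ 0) : HasGamma1 (ker l) (sgnPi l) := by
  have h1 : I ∈ slitPlane := by simp [mem_slitPlane_iff]
  have h2 : -I ∈ slitPlane := by simp [mem_slitPlane_iff]
  rcases hl.lt_or_gt with h | h
  · refine (hasGamma1_ker_of_rotation (c := -I) (by simp) h2 (by simpa using h1) hl
      (by simpa using h)).congr ?_
    rw [sgnPi_of_neg h, neg_neg, log_I, log_neg_I]
    ring
  · refine (hasGamma1_ker_of_rotation (c := I) (by simp) h1 h2 hl (by simpa using h)).congr ?_
    rw [sgnPi_of_pos h, log_I, log_neg_I]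
    ring

/-- `∫ dx / ((x - a) (x - b))`. -/
noncomputable def pair (a b : ℂ) : ℂ := inner ℂ (ker (conj a)) (ker b)

/-- This is `Γ₁` applied to the identity `ker_sub_ker`; it replaces a residue computation. -/
theorem sub_mul_pair {a b : ℂ} (ha : a.im ≠ 0) (hb : b.im ≠ 0) :
    (a - b) * pair a b = sgnPi a - sgnPi b := by
  have h1 := (hasGamma1_res ha (ker b)).smul (a - b)
  rw [← ker_sub_ker ha hb] at h1
  exact h1.unique ((hasGamma1_ker ha).sub (hasGamma1_ker hb))

theorem pair_same {a b : ℂ} (h : 0 < a.im * b.im) : pair a b = 0 := by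
  have ne : ∀ c : ℂ, 0 < a.im * c.im → c ≠ a → pair a c = 0 := by
    intro c hc hca
    have ha : a.im ≠ 0 := left_ne_zero_of_mul hc.ne'
    have hc' : c.im ≠ 0 := right_ne_zero_of_mul hc.ne'
    have h1 := sub_mul_pair ha hc'
    have h2 : sgnPi a = sgnPi c := by
      rcases pos_and_pos_or_neg_and_neg_of_mul_pos hc with h | h
      · rw [sgnPi_of_pos h.1, sgnPi_of_pos h.2]
      · rw [sgnPi_of_neg h.1, sgnPi_of_neg h.2]
    rw [h2, sub_self] at h1
    exact (mul_eq_zero.1 h1).resolve_left (sub_ne_zero.2 hca.symm)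
  have hb : b.im ≠ 0 := right_ne_zero_of_mul h.ne'
  by_cases hba : b = a
  · subst hba
    -- For equal arguments `sub_mul_pair` is empty, so the value comes from continuity in the second
    -- argument.
    have h1 : Tendsto (fun c => pair b c) (𝓝[≠] b) (𝓝 (pair b b)) :=
      (tendsto_const_nhds.inner (tendsto_ker hb)).mono_left nhdsWithin_le_nhds
    refine tendsto_nhds_unique h1 (tendsto_const_nhds.congr' ?_)
    have h2 : ∀ᶠ c : ℂ in 𝓝 b, 0 < b.im * c.im :=
      (continuous_const.mul continuous_im).continuousAt.eventually (lt_mem_nhds h)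
    filter_upwards [eventually_mem_nhdsWithin, nhdsWithin_le_nhds h2] with c hc hc'
    exact (ne c hc' hc).symm
  · exact ne b h hba

theorem pair_pos_neg {a b : ℂ} (ha : 0 < a.im) (hb : b.im < 0) :
    pair a b = 2 * Real.pi * I / (a - b) := by
  have hab : a - b ≠ 0 := by
    intro h
    have := congrArg Complex.im h
    simp only [sub_im, zero_im] at this
    linarith
  rw [eq_div_iff hab, mul_comm, sub_mul_pair ha.ne' hb.ne, sgnPi_of_pos ha, sgnPi_of_neg hb]
  ring

theorem pair_comm {a b : ℂ} (ha : a.im ≠ 0) (hb : b.im ≠ 0) : pair a b = pair b a := by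
  rw [pair, pair, inner_ker_conj ha, inner_ker_conj hb]
  refine integral_congr_ae ?_
  filter_upwards [coeFn_ker ha, coeFn_ker hb] with x h1 h2
  rw [h1, h2, mul_comm]

theorem inner_res_right {l : ℂ} (hl : l.im ≠ 0) (f g : L2) :
    inner ℂ f (res l g) = inner ℂ (res (conj l) f) g := by
  rw [inner_L2_eq, inner_L2_eq]
  refine integral_congr_ae ?_
  filter_upwards [coeFn_res hl g, coeFn_res (conj_im_ne_zero hl) f] with x h1 h2
  rw [h1, h2]
  simp
  ring

theorem res_ker_comm {a b : ℂ} (ha : a.im ≠ 0) (hb : b.im ≠ 0) :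
    res a (ker b) = res b (ker a) := by
  refine Lp.ext ?_
  filter_upwards [coeFn_res ha (ker b), coeFn_res hb (ker a), coeFn_ker ha, coeFn_ker hb]
    with x h1 h2 h3 h4
  rw [h1, h2, h3, h4, mul_comm]

theorem norm_ker_sq {l : ℂ} (hl : l.im ≠ 0) : ‖ker l‖ ^ 2 = Real.pi / |l.im| := by
  have h1 : ((‖ker l‖ ^ 2 : ℝ) : ℂ) = pair (conj l) l := by
    rw [pair, conj_conj, inner_self_eq_norm_sq_to_K]
    simp
  have h2 := sub_mul_pair (conj_im_ne_zero hl) hl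
  rw [← h1] at h2
  have h3 : (conj l - l) = -(2 * l.im * I) := by
    apply Complex.ext
    · simp
    · simp
      ring
  rw [h3] at h2
  rcases hl.lt_or_gt with h | h
  · rw [sgnPi_of_pos (by simpa using h), sgnPi_of_neg h] at h2
    have h4 := congrArg Complex.im h2
    simp [pow_two] at h4
    rw [abs_of_neg h, eq_div_iff (by linarith)]
    nlinarith
  · rw [sgnPi_of_neg (by simpa using h), sgnPi_of_pos h] at h2
    have h4 := congrArg Complex.im h2
    simp [pow_two] at h4
    rw [abs_of_pos h, eq_div_iff (by linarith)]
    nlinarith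

/-! ### The minimal operator is densely defined -/

theorem res_ker_mem_minDomain {a b : ℂ} (h : 0 < a.im * b.im) : res a (ker b) ∈ minDomain := by
  have ha : a.im ≠ 0 := left_ne_zero_of_mul h.ne'
  refine ⟨?_, ?_⟩
  · simpa [HasGamma2] using hasGamma2_res ha (ker b)
  · have := hasGamma1_res ha (ker b)
    rwa [← pair, pair_same h] at this

theorem tendsto_ker_atTop (σ : ℝ) (hσ : σ ≠ 0) :
    Tendsto (fun t : ℝ => ker (σ * t * I)) atTop (𝓝 0) := by
  rw [tendsto_zero_iff_norm_tendsto_zero]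
  have h1 : Tendsto (fun t : ℝ => Real.sqrt (Real.pi / |σ * t|)) atTop (𝓝 0) := by
    have h2 : Tendsto (fun t : ℝ => |σ * t|) atTop atTop := by
      simp_rw [abs_mul]
      exact tendsto_abs_atTop_atTop.const_mul_atTop (abs_pos.2 hσ)
    have := (Real.continuous_sqrt.tendsto 0).comp (h2.const_div_atTop Real.pi)
    simpa [Function.comp_def] using this
  refine h1.congr' ?_
  filter_upwards [eventually_gt_atTop 0] with t ht
  have him : ((σ : ℂ) * t * I).im = σ * t := by simp
  have hl : ((σ : ℂ) * t * I).im ≠ 0 := by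
    rw [him]
    exact mul_ne_zero hσ ht.ne'
  rw [← him, ← norm_ker_sq hl, Real.sqrt_sq (norm_nonneg _)]

/-- Within one half-plane `Γ₁` is the same for all kernels, so `ker l - ker (i t Im l)` lies in the
domain; the second kernel tends to zero as `t → ∞`. -/
theorem dense_minDomain : Dense (minDomain : Set L2) := by
  have hcl : IsClosed (minDomain.topologicalClosure : Set L2) :=
    Submodule.isClosed_topologicalClosure _
  have : minDomain.topologicalClosure = ⊤ := by
    refine eq_top_of_ker_mem hcl dense_univ fun l _ => ?_
    by_cases hl : l.im = 0
    · simp [ker, hl]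
    have h1 : Tendsto (fun t : ℝ => ker l - ker (l.im * t * I)) atTop (𝓝 (ker l)) := by
      simpa using tendsto_const_nhds.sub (tendsto_ker_atTop l.im hl)
    refine hcl.mem_of_tendsto h1 ?_
    filter_upwards [eventually_gt_atTop 0] with t ht
    have him : ((l.im : ℂ) * t * I).im = l.im * t := by simp
    have hpos : 0 < l.im * ((l.im : ℂ) * t * I).im := by
      rw [him, ← mul_assoc]
      exact mul_pos (mul_self_pos.2 hl) ht
    rw [ker_sub_ker hl (right_ne_zero_of_mul hpos.ne')]
    exact Submodule.le_topologicalClosure _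
      (minDomain.smul_mem _ (res_ker_mem_minDomain hpos))
  rw [Submodule.dense_iff_topologicalClosure_eq_top, this]

/-! ### The maximal operator and its boundary restrictions -/

/-- `f` is the product of the two `L²` functions `1/(x - i)` and `x f - i f`. -/
theorem integrable_of_mem_minDomain {f : L2} (hf : f ∈ minDomain) : Integrable f volume := by
  have hI : (I : ℂ).im ≠ 0 := by simp
  refine (integrable_cauchy_mul hI (hf.1.toLp - I • f)).congr ?_
  filter_upwards [Lp.coeFn_sub hf.1.toLp (I • f), Lp.coeFn_smul I f, hf.1.coeFn_toLp]
    with x h1 h2 h3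
  have := ofReal_sub_ne_zero hI x
  rw [h1, Pi.sub_apply, h2, h3, Pi.smul_apply, smul_eq_mul]
  field_simp

theorem integral_eq_zero_of_mem_minDomain {f : L2} (hf : f ∈ minDomain) : ∫ x, f x = 0 :=
  tendsto_nhds_unique (intervalIntegral_tendsto_integral (integrable_of_mem_minDomain hf)
    tendsto_neg_atTop_atBot tendsto_id) hf.2

/-- The constant `c` contributes a multiple of `∫ f = 0`; this is where the vanishing mean in the
minimal domain acts. -/
theorem inner_toLp_of_mem_minDomain {u f : L2} {c : ℂ} (h : HasGamma2 u c) (hf : f ∈ minDomain) :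
    inner ℂ h.toLp f = inner ℂ u hf.1.toLp := by
  rw [inner_L2_eq, inner_L2_eq]
  have h1 : Integrable (fun x => conj (u x) * ((x : ℂ) * f x)) volume := by
    refine (L2.integrable_inner (𝕜 := ℂ) u hf.1.toLp).congr ?_
    filter_upwards [hf.1.coeFn_toLp] with x hx
    rw [hx, RCLike.inner_apply, mul_comm]
  have h2 : Integrable (fun x => conj c * f x) volume :=
    (integrable_of_mem_minDomain hf).const_mul _
  calc ∫ x, conj (h.toLp _ x) * f x
      = ∫ x, (conj (u x) * ((x : ℂ) * f x) - conj c * f x) := by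
        refine integral_congr_ae ?_
        filter_upwards [h.coeFn_toLp] with x hx
        rw [hx]
        simp only [map_sub, map_mul, conj_ofReal]
        ring
    _ = ∫ x, conj (u x) * ((x : ℂ) * f x) := by
        rw [integral_sub h1 h2, integral_const_mul, integral_eq_zero_of_mem_minDomain hf, mul_zero,
          sub_zero]
    _ = ∫ x, conj (u x) * hf.1.toLp _ x := by
        refine integral_congr_ae ?_
        filter_upwards [hf.1.coeFn_toLp] with x hx
        rw [hx]

theorem inner_maxOp_formula (φ ψ : L2) {u : L2} {c : ℂ} (h : HasGamma2 u c)
    (f : (minOp ψ φ).domain) :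
    inner ℂ (h.toLp + inner ℂ φ u • ψ) (f : L2) = inner ℂ u (minOp ψ φ f) := by
  have hf : minOp ψ φ f = f.2.1.toLp + inner ℂ ψ (f : L2) • φ := rfl
  rw [hf, inner_add_left, inner_add_right, inner_smul_left, inner_smul_right, inner_conj_symm,
    inner_toLp_of_mem_minDomain h f.2, mul_comm]

/-- Only this inclusion is needed: elements of `opB` domains and solutions in `SolutionOp` carry a
value of `Γ₂` by definition. -/
theorem mem_maxOp_domain (φ ψ : L2) {u : L2} {c : ℂ} (h : HasGamma2 u c) :
    u ∈ (maxOp φ ψ).domain :=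
  LinearPMap.mem_adjoint_domain_of_exists _ ⟨_, inner_maxOp_formula φ ψ h⟩

theorem maxOp_apply {φ ψ : L2} {c : ℂ} (v : (maxOp φ ψ).domain) (h : HasGamma2 (v : L2) c) :
    maxOp φ ψ v = h.toLp + inner ℂ φ (v : L2) • ψ :=
  LinearPMap.adjoint_apply_eq dense_minDomain v (inner_maxOp_formula φ ψ h)

theorem maxOp_sub_smul_eq_iff {φ ψ : L2} {c l : ℂ} (hl : l.im ≠ 0) (v : (maxOp φ ψ).domain)
    (h : HasGamma2 (v : L2) c) (g : L2) :
    maxOp φ ψ v - l • (v : L2) = g ↔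
      (v : L2) = res l g + c • ker l - inner ℂ φ (v : L2) • res l ψ := by
  rw [maxOp_apply v h]
  set s : ℂ := inner ℂ φ (v : L2)
  set u : L2 := (v : L2)
  have hL : (h.toLp + s • ψ - l • u : L2) =ᵐ[volume]
      fun x : ℝ => (x : ℂ) * u x - c + s * ψ x - l * u x := by
    filter_upwards [Lp.coeFn_sub (h.toLp + s • ψ) (l • u), Lp.coeFn_add h.toLp (s • ψ),
      Lp.coeFn_smul s ψ, Lp.coeFn_smul l u, h.coeFn_toLp] with x h1 h2 h3 h4 h5
    simp only [h1, h2, h3, h4, h5, Pi.sub_apply, Pi.add_apply, Pi.smul_apply, smul_eq_mul]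
  have hR : (res l g + c • ker l - s • res l ψ : L2) =ᵐ[volume]
      fun x : ℝ => (g x + c - s * ψ x) / ((x : ℂ) - l) := by
    filter_upwards [Lp.coeFn_sub (res l g + c • ker l) (s • res l ψ),
      Lp.coeFn_add (res l g) (c • ker l), Lp.coeFn_smul s (res l ψ), Lp.coeFn_smul c (ker l),
      coeFn_res hl g, coeFn_res hl ψ, coeFn_ker hl] with x h1 h2 h3 h4 h5 h6 h7
    simp only [h1, h2, h3, h4, h5, h6, h7, Pi.sub_apply, Pi.add_apply, Pi.smul_apply, smul_eq_mul]
    ring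
  constructor
  · intro hg
    refine Lp.ext ?_
    filter_upwards [hR, hL, Lp.ext_iff.1 hg] with x h1 h2 h3
    have := ofReal_sub_ne_zero hl x
    rw [h1, ← h3, h2]
    field_simp
    ring
  · intro hu
    refine Lp.ext ?_
    filter_upwards [hR, hL, Lp.ext_iff.1 hu] with x h1 h2 h3
    have := ofReal_sub_ne_zero hl x
    rw [h1] at h3
    rw [h2]
    rw [eq_div_iff this] at h3
    linear_combination h3

theorem hasGamma1_ansatz {l : ℂ} (hl : l.im ≠ 0) (g ψ : L2) (c s : ℂ) :
    HasGamma1 (res l g + c • ker l - s • res l ψ)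
      (inner ℂ (ker (conj l)) g + c * sgnPi l - s * inner ℂ (ker (conj l)) ψ) :=
  ((hasGamma1_res hl g).add ((hasGamma1_ker hl).smul c)).sub ((hasGamma1_res hl ψ).smul s)

theorem hasGamma2_ansatz {l : ℂ} (hl : l.im ≠ 0) (g ψ : L2) (c s : ℂ) :
    HasGamma2 (res l g + c • ker l - s • res l ψ) c := by
  have h := ((hasGamma2_res hl g).add ((hasGamma2_ker hl).smul c)).add
    ((hasGamma2_res hl ψ).smul (-s))
  rw [neg_smul, ← sub_eq_add_neg] at h
  exact h.congr (by ring)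

theorem opB_sub_smul_eq_iff {φ ψ : L2} {B c l : ℂ} (hl : l.im ≠ 0) (f : (opB φ ψ B).domain)
    (h : HasGamma2 (f : L2) c) (g : L2) :
    opB φ ψ B f - l • (f : L2) = g ↔
      (f : L2) = res l g + c • ker l - inner ℂ φ (f : L2) • res l ψ :=
  maxOp_sub_smul_eq_iff hl ⟨f, f.2.2⟩ h g

theorem mem_opB_domain (φ ψ : L2) {B a c : ℂ} {u : L2} (h1 : HasGamma1 u a) (h2 : HasGamma2 u c)
    (h : a = B * c) : u ∈ (opB φ ψ B).domain :=
  ⟨⟨a, c, h1, h2, h⟩, mem_maxOp_domain φ ψ h2⟩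

theorem maxOp_eq_of_eq {φ ψ : L2} {c l : ℂ} (hl : l.im ≠ 0) {u g : L2} (h : HasGamma2 u c)
    (hu : u = res l g + c • ker l - inner ℂ φ u • res l ψ) :
    ∃ v : (maxOp φ ψ).domain, (v : L2) = u ∧ maxOp φ ψ v - l • (v : L2) = g :=
  ⟨⟨u, mem_maxOp_domain φ ψ h⟩, rfl,
    (maxOp_sub_smul_eq_iff hl ⟨u, mem_maxOp_domain φ ψ h⟩ h g).2 hu⟩

theorem opB_eq_of_eq {φ ψ : L2} {B a c l : ℂ} (hl : l.im ≠ 0) {u g : L2} (h1 : HasGamma1 u a)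
    (h2 : HasGamma2 u c) (h : a = B * c)
    (hu : u = res l g + c • ker l - inner ℂ φ u • res l ψ) :
    ∃ v : (opB φ ψ B).domain, (v : L2) = u ∧ opB φ ψ B v - l • (v : L2) = g :=
  ⟨⟨u, mem_opB_domain φ ψ h1 h2 h⟩, rfl,
    (opB_sub_smul_eq_iff hl ⟨u, mem_opB_domain φ ψ h1 h2 h⟩ h2 g).2 hu⟩

/-- A point at which the boundary problem for `A_B` is explicitly uniquely solvable. -/
structure Regular (φ ψ : L2) (B l : ℂ) : Prop where
  im_ne : l.im ≠ 0
  inner_mul : inner ℂ φ (ker l) * inner ℂ (ker (conj l)) ψ = 0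
  det_ne : 1 + inner ℂ φ (res l ψ) ≠ 0
  ne_sgnPi : B ≠ sgnPi l

/-- The functionals `s` and `c` are given by Cramer's rule for the system `hsys1`, `hsys2`. Its
determinant `(1 + Q)(B - sgnPi l) + F G` factors because `F G = 0`. -/
theorem Regular.mem_resolvSet {φ ψ : L2} {B l : ℂ} (h : Regular φ ψ B l) :
    l ∈ resolvSet (opB φ ψ B) := by
  obtain ⟨hl, hFG, hD, hB⟩ := h
  set F : ℂ := inner ℂ φ (ker l) with hF
  set G : ℂ := inner ℂ (ker (conj l)) ψ with hG
  set Q : ℂ := inner ℂ φ (res l ψ) with hQ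
  have hE : B - sgnPi l ≠ 0 := sub_ne_zero.2 hB
  obtain ⟨a, ha⟩ : ∃ a : L2 →L[ℂ] ℂ, ∀ g, a g = inner ℂ φ (res l g) :=
    ⟨innerSL ℂ φ ∘L res l, fun g => rfl⟩
  obtain ⟨b, hb⟩ : ∃ b : L2 →L[ℂ] ℂ, ∀ g, b g = inner ℂ (ker (conj l)) g :=
    ⟨innerSL ℂ (ker (conj l)), fun g => rfl⟩
  obtain ⟨s, hs⟩ : ∃ s : L2 →L[ℂ] ℂ, ∀ g,
      s g = ((1 + Q) * (B - sgnPi l))⁻¹ * ((B - sgnPi l) * a g + F * b g) :=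
    ⟨((1 + Q) * (B - sgnPi l))⁻¹ • ((B - sgnPi l) • a + F • b), fun g => rfl⟩
  obtain ⟨c, hc⟩ : ∃ c : L2 →L[ℂ] ℂ, ∀ g,
      c g = ((1 + Q) * (B - sgnPi l))⁻¹ * ((1 + Q) * b g - G * a g) :=
    ⟨((1 + Q) * (B - sgnPi l))⁻¹ • ((1 + Q) • b - G • a), fun g => rfl⟩
  obtain ⟨R, hR⟩ : ∃ R : L2 →L[ℂ] L2, ∀ g, R g = res l g + c g • ker l - s g • res l ψ :=
    ⟨res l + c.smulRight (ker l) - s.smulRight (res l ψ), fun g => rfl⟩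
  have hsys1 : ∀ g, (1 + Q) * s g - F * c g = a g := fun g => by
    rw [hs, hc]
    field_simp
    linear_combination (a g) * hFG
  have hsys2 : ∀ g, (B - sgnPi l) * c g + G * s g = b g := fun g => by
    rw [hs, hc]
    field_simp
    linear_combination (b g) * hFG
  have hinner : ∀ g (c s : ℂ), inner ℂ φ (res l g + c • ker l - s • res l ψ)
      = a g + c * F - s * Q := fun g c s => by
    rw [inner_sub_right, inner_add_right, inner_smul_right, inner_smul_right,
      ← ha]
  refine ⟨R, fun g => ?_, fun f => ?_⟩
  · have h1 := hasGamma1_ansatz hl g ψ (c g) (s g)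
    have h2 := hasGamma2_ansatz hl g ψ (c g) (s g)
    rw [← hR] at h1 h2
    refine opB_eq_of_eq hl h1 h2 ?_ ?_
    · rw [← hb, ← hG]
      linear_combination -(hsys2 g)
    · have : inner ℂ φ (R g) = s g := by
        rw [hR, hinner]
        linear_combination -(hsys1 g)
      rw [this, hR]
  · obtain ⟨a', c', h1, h2, h3⟩ := f.2.1
    set g := opB φ ψ B f - l • (f : L2) with hg
    have hf := (opB_sub_smul_eq_iff hl f h2 g).1 hg.symm
    set s' : ℂ := inner ℂ φ (f : L2) with hs'
    have e1 : s' = a g + c' * F - s' * Q := by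
      rw [← hinner, ← hf]
    have e2 : a' = b g + c' * sgnPi l - s' * G := by
      rw [hf] at h1
      rw [hb]
      exact h1.unique (hasGamma1_ansatz hl g ψ c' s')
    have e3 : s g = s' := by
      rw [hs, inv_mul_eq_iff_eq_mul₀ (mul_ne_zero hD hE)]
      linear_combination (-(B - sgnPi l)) * e1 - F * e2 + F * h3 + s' * hFG
    have e4 : c g = c' := by
      rw [hc, inv_mul_eq_iff_eq_mul₀ (mul_ne_zero hD hE)]
      linear_combination (-(1 + Q)) * e2 + G * e1 + (1 + Q) * h3 + c' * hFG
    rw [hR, e3, e4, ← hf]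

/-- The solution of the homogeneous equation at a regular point with `Γ₂ = 1`. -/
noncomputable def solKer (φ ψ : L2) (l : ℂ) : L2 :=
  ker l - (inner ℂ φ (ker l) / (1 + inner ℂ φ (res l ψ))) • res l ψ

theorem Regular.solutionOp_smul {φ ψ : L2} {B l : ℂ} (h : Regular φ ψ B l) (c : ℂ) :
    SolutionOp φ ψ B l (c * (sgnPi l - B)) (c • solKer φ ψ l) := by
  obtain ⟨hl, hFG, hD, hB⟩ := h
  set F : ℂ := inner ℂ φ (ker l) with hF
  set G : ℂ := inner ℂ (ker (conj l)) ψ with hG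
  set Q : ℂ := inner ℂ φ (res l ψ) with hQ
  have e : c • solKer φ ψ l = res l 0 + c • ker l - (c * (F / (1 + Q))) • res l ψ := by
    rw [solKer, map_zero, zero_add, smul_sub, smul_smul]
  have h1 := hasGamma1_ansatz hl 0 ψ c (c * (F / (1 + Q)))
  have h2 := hasGamma2_ansatz hl 0 ψ c (c * (F / (1 + Q)))
  rw [← e] at h1 h2
  refine ⟨maxOp_eq_of_eq hl h2 ?_, _, _, h1, h2, ?_⟩
  · have : inner ℂ φ (c • solKer φ ψ l) = c * (F / (1 + Q)) := by
      rw [solKer, inner_smul_right, inner_sub_right, inner_smul_right, ← hF, ← hQ]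
      field_simp
      ring
    rw [this, e]
  · rw [inner_zero_right, ← hG]
    field_simp
    linear_combination (-c) * hFG

theorem Regular.eq_smul_of_mem_ran {φ ψ : L2} {B l : ℂ} (h : Regular φ ψ B l) {u : L2}
    (hu : u ∈ ranSolutionOp φ ψ B l) : ∃ c : ℂ, u = c • solKer φ ψ l := by
  obtain ⟨hl, hFG, hD, hB⟩ := h
  obtain ⟨_, ⟨v, rfl, hv⟩, a, c, h1, h2, -⟩ := hu
  refine ⟨c, ?_⟩
  have e := (maxOp_sub_smul_eq_iff hl v h2 0).1 hv
  set s : ℂ := inner ℂ φ (v : L2) with hs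
  have e1 : s = c * inner ℂ φ (ker l) - s * inner ℂ φ (res l ψ) := by
    conv_lhs => rw [hs, e]
    rw [inner_sub_right, inner_add_right, inner_smul_right, inner_smul_right, map_zero,
      inner_zero_right, zero_add]
  have e2 : s = c * (inner ℂ φ (ker l) / (1 + inner ℂ φ (res l ψ))) := by
    field_simp
    linear_combination e1
  rw [e, solKer, map_zero, zero_add, smul_sub, smul_smul, e2]

/-! ### The detectable subspaces as spans of solution kernels -/

/-- The resolvent identity `F δ - f = (δ - μ) R (F δ)` uses only the bounded inverse `R` at `μ`. It
first bounds `‖F δ‖` by `2 ‖f‖` near `μ` and then gives convergence. -/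
theorem tendsto_resolvent {T : L2 →ₗ.[ℂ] L2} {μ : ℂ} (hμ : μ ∈ resolvSet T) {v : L2}
    {f : T.domain} (hf : T f - μ • (f : L2) = v) {G : Set ℂ} {F : ℂ → T.domain}
    (hF : ∀ δ ∈ G, T (F δ) - δ • (F δ : L2) = v) :
    Tendsto (fun δ => (F δ : L2)) (𝓝[G] μ) (𝓝 (f : L2)) := by
  obtain ⟨R, -, hR⟩ := hμ
  have hd : ∀ δ ∈ G, (F δ : L2) - f = (δ - μ) • R (F δ) := fun δ hδ => by
    have h1 := hR (F δ - f)
    rw [LinearPMap.map_sub, Submodule.coe_sub] at h1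
    rw [← h1, ← map_smul]
    congr 1
    have h2 : T (F δ) = v + δ • (F δ : L2) := by rw [← hF δ hδ]; abel
    have h3 : T f = v + μ • (f : L2) := by rw [← hf]; abel
    rw [h2, h3]
    module
  rw [tendsto_iff_norm_sub_tendsto_zero]
  have ht : Tendsto (fun δ : ℂ => ‖δ - μ‖) (𝓝[G] μ) (𝓝 0) := by
    have : Tendsto (fun δ : ℂ => ‖δ - μ‖) (𝓝 μ) (𝓝 ‖μ - μ‖) :=
      (continuous_id.sub continuous_const).norm.tendsto μ
    rw [sub_self, norm_zero] at this
    exact this.mono_left nhdsWithin_le_nhds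
  have hsmall : ∀ᶠ δ in 𝓝[G] μ, ‖δ - μ‖ * ‖R‖ < 1 / 2 := by
    have := ht.mul_const ‖R‖
    rw [zero_mul] at this
    exact this.eventually_lt_const (by norm_num)
  refine squeeze_zero' (Eventually.of_forall fun _ => norm_nonneg _) ?_
    (by simpa using ht.mul_const (‖R‖ * (2 * ‖(f : L2)‖)))
  filter_upwards [eventually_mem_nhdsWithin, hsmall] with δ hδ hδ'
  have h1 : ‖(F δ : L2) - f‖ ≤ ‖δ - μ‖ * (‖R‖ * ‖(F δ : L2)‖) := by
    rw [hd δ hδ, norm_smul]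
    exact mul_le_mul_of_nonneg_left (R.le_opNorm _) (norm_nonneg _)
  have h2 : ‖(F δ : L2)‖ ≤ 2 * ‖(f : L2)‖ := by
    have h3 := norm_sub_norm_le (F δ : L2) f
    have h4 : ‖δ - μ‖ * ‖R‖ * ‖(F δ : L2)‖ ≤ 1 / 2 * ‖(F δ : L2)‖ :=
      mul_le_mul_of_nonneg_right hδ'.le (norm_nonneg _)
    linarith
  exact h1.trans (by gcongr)

theorem exists_resolvent_family {T : L2 →ₗ.[ℂ] L2} {G : Set ℂ} (hG : G ⊆ resolvSet T) (v : L2) :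
    ∃ F : ℂ → T.domain, ∀ δ ∈ G, T (F δ) - δ • (F δ : L2) = v := by
  have h : ∀ δ : ℂ, ∃ f : T.domain, δ ∈ G → T f - δ • (f : L2) = v := fun δ => by
    by_cases hδ : δ ∈ G
    · obtain ⟨R, hR, -⟩ := hG hδ
      obtain ⟨f, -, hf⟩ := hR v
      exact ⟨f, fun _ => hf⟩
    · exact ⟨0, fun h => absurd h hδ⟩
  choose F hF using h
  exact ⟨F, hF⟩

/-- This is `S_{μ,B} = (1 + (μ - l)(A_B - μ)⁻¹) S_{l,B}`: the added term satisfies the homogeneous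
boundary condition, so `h` is unchanged. -/
theorem SolutionOp.shift {φ ψ : L2} {B l μ h : ℂ} {u : L2} (hu : SolutionOp φ ψ B l h u)
    {f : (opB φ ψ B).domain} (hf : opB φ ψ B f - μ • (f : L2) = u) :
    SolutionOp φ ψ B μ h (u + (μ - l) • (f : L2)) := by
  obtain ⟨⟨v, rfl, hv⟩, a, c, ha, hc, hac⟩ := hu
  obtain ⟨a', c', ha', hc', hac'⟩ := f.2.1
  let w : (maxOp φ ψ).domain := ⟨f, f.2.2⟩
  have hw : maxOp φ ψ w = opB φ ψ B f := rfl
  refine ⟨⟨v + (μ - l) • w, rfl, ?_⟩, _, _, ha.add (ha'.smul _), hc.add (hc'.smul _), ?_⟩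
  · rw [LinearPMap.map_add, LinearPMap.map_smul, hw, sub_eq_zero.1 hv, sub_eq_iff_eq_add.1 hf,
      Submodule.coe_add, Submodule.coe_smul]
    change _ - μ • ((v : L2) + (μ - l) • (f : L2)) = 0
    module
  · rw [hac', ← hac]
    ring

theorem SolutionOp.eq {φ ψ : L2} {B μ h : ℂ} (hμ : μ ∈ resolvSet (opB φ ψ B)) {u u' : L2}
    (hu : SolutionOp φ ψ B μ h u) (hu' : SolutionOp φ ψ B μ h u') : u = u' := by
  obtain ⟨⟨v, rfl, hv⟩, a, c, ha, hc, hac⟩ := hu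
  obtain ⟨⟨v', rfl, hv'⟩, a', c', ha', hc', hac'⟩ := hu'
  obtain ⟨R, -, hR⟩ := hμ
  have hc2 : HasGamma2 ((v - v' : (maxOp φ ψ).domain) : L2) (c - c') := by
    have := hc.add (hc'.smul (-1))
    rw [neg_one_smul, ← sub_eq_add_neg, ← Submodule.coe_sub] at this
    exact this.congr (by ring)
  let f : (opB φ ψ B).domain :=
    ⟨v - v', ⟨a - a', c - c', ha.sub ha', hc2, by linear_combination hac - hac'⟩, (v - v').2⟩
  have hf : opB φ ψ B f = maxOp φ ψ (v - v') := rfl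
  have h1 := hR f
  have h2 : opB φ ψ B f - μ • (f : L2) = 0 := by
    rw [hf, LinearPMap.map_sub, sub_eq_zero.1 hv, sub_eq_zero.1 hv']
    change _ - μ • ((v : L2) - v') = 0
    module
  rw [h2, map_zero] at h1
  exact sub_eq_zero.1 h1.symm

/-- The non-real points outside `E`. -/
def nonRealDiff (E : Set ℂ) : Set ℂ := {l | l.im ≠ 0} \ E

theorem dense_nonRealDiff {E : Set ℂ} (hE : E.Finite) : Dense (nonRealDiff E) :=
  Dense.sdiff_finite (Dense.preimage (dense_compl_singleton (0 : ℝ)) isOpenMap_im) hE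

/-- The closed linear span of the solution kernels at the non-real points outside `E`. -/
noncomputable def solSpan (φ ψ : L2) (E : Set ℂ) : Submodule ℂ L2 :=
  (Submodule.span ℂ (solKer φ ψ '' nonRealDiff E)).topologicalClosure

theorem isClosed_solSpan (φ ψ : L2) (E : Set ℂ) : IsClosed (solSpan φ ψ E : Set L2) :=
  Submodule.isClosed_topologicalClosure _

/-! ### Reduction of both detectable spaces to the span of solution kernels. -/

section Detectable

variable {φ ψ : L2} {B : ℂ} {E : Set ℂ} (hE : E.Finite)
  (hreg : ∀ l ∈ nonRealDiff E, Regular φ ψ B l)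

include hE hreg

/-- Here `μ` may be real or exceptional; its solution is the limit of shifted solutions at regular
points. -/
theorem ranSolutionOp_subset_solSpan {μ : ℂ} (hμ : μ ∈ resolvSet (opB φ ψ B)) {u : L2}
    (hu : u ∈ ranSolutionOp φ ψ B μ) : u ∈ solSpan φ ψ E := by
  obtain ⟨h, hu⟩ := hu
  obtain ⟨R, hR, -⟩ := id hμ
  obtain ⟨f, -, hf⟩ := hR u
  obtain ⟨F, hF⟩ := exists_resolvent_family (fun l hl => (hreg l hl).mem_resolvSet) u
  have hlim := tendsto_resolvent hμ hf hF
  have : (𝓝[nonRealDiff E] μ).NeBot :=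
    mem_closure_iff_nhdsWithin_neBot.1 (dense_nonRealDiff hE μ)
  have h1 : Tendsto (fun δ : ℂ => δ - μ) (𝓝[nonRealDiff E] μ) (𝓝 0) := by
    have h2 : Tendsto (fun δ : ℂ => δ - μ) (𝓝 μ) (𝓝 (μ - μ)) :=
      (continuous_id.sub continuous_const).tendsto μ
    rw [sub_self] at h2
    exact h2.mono_left nhdsWithin_le_nhds
  have h2 : Tendsto (fun δ => u + (δ - μ) • (F δ : L2)) (𝓝[nonRealDiff E] μ) (𝓝 u) := by
    simpa using tendsto_const_nhds.add (h1.smul hlim)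
  refine (isClosed_solSpan φ ψ E).mem_of_tendsto h2 ?_
  filter_upwards [eventually_mem_nhdsWithin] with δ hδ
  obtain ⟨c, hc⟩ := (hreg δ hδ).eq_smul_of_mem_ran ⟨h, hu.shift (hF δ hδ)⟩
  rw [hc]
  exact Submodule.smul_mem _ _
    (Submodule.le_topologicalClosure _ (Submodule.subset_span ⟨δ, hδ, rfl⟩))

theorem detectableT_eq_solSpan : detectableT φ ψ B = solSpan φ ψ E := by
  refine le_antisymm ?_ ?_
  · refine Submodule.topologicalClosure_minimal _ (Submodule.span_le.2 ?_)
      (isClosed_solSpan φ ψ E)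
    rintro u ⟨μ, hμ, hu⟩
    exact ranSolutionOp_subset_solSpan hE hreg hμ hu
  · refine Submodule.topologicalClosure_mono (Submodule.span_mono ?_)
    rintro _ ⟨l, hl, rfl⟩
    exact ⟨l, (hreg l hl).mem_resolvSet, sgnPi l - B,
      by simpa using (hreg l hl).solutionOp_smul 1⟩

theorem detectableS_le_solSpan {μ₀ : ℂ} (hμ₀ : μ₀ ∈ resolvSet (opB φ ψ B)) :
    detectableS φ ψ B μ₀ ≤ solSpan φ ψ E := by
  refine Submodule.topologicalClosure_minimal _ (Submodule.span_le.2 ?_) (isClosed_solSpan φ ψ E)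
  rintro _ ⟨δ, hδ, f, rfl, h, hu⟩
  set u := opB φ ψ B f - δ • (f : L2) with hf
  -- Removing `μ₀` permits division by `l - μ₀` in `(A_B - l)⁻¹ S_{μ₀,B} h = (l - μ₀)⁻¹ (S_{l,B} h -
  -- S_{μ₀,B} h)`.
  have hE' : (insert μ₀ E).Finite := hE.insert μ₀
  have hsub : nonRealDiff (insert μ₀ E) ⊆ nonRealDiff E :=
    Set.sdiff_subset_sdiff_right (Set.subset_insert _ _)
  obtain ⟨F, hF⟩ := exists_resolvent_family (T := opB φ ψ B) (G := nonRealDiff (insert μ₀ E))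
    (fun l hl => (hreg l (hsub hl)).mem_resolvSet) u
  have : (𝓝[nonRealDiff (insert μ₀ E)] δ).NeBot :=
    mem_closure_iff_nhdsWithin_neBot.1 (dense_nonRealDiff hE' δ)
  refine (isClosed_solSpan φ ψ E).mem_of_tendsto (tendsto_resolvent hδ hf.symm hF) ?_
  filter_upwards [eventually_mem_nhdsWithin] with l hl
  have h1 := ranSolutionOp_subset_solSpan hE hreg hμ₀ ⟨h, hu⟩
  have h2 := ranSolutionOp_subset_solSpan hE hreg (hreg l (hsub hl)).mem_resolvSet
    ⟨h, hu.shift (hF l hl)⟩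
  have hne : l - μ₀ ≠ 0 := sub_ne_zero.2 fun h => hl.2 (h ▸ Set.mem_insert _ _)
  have h3 := Submodule.smul_mem _ (l - μ₀)⁻¹ (Submodule.sub_mem _ h2 h1)
  rwa [add_sub_cancel_left, smul_smul, inv_mul_cancel₀ hne, one_smul] at h3

theorem solSpan_le_detectableS (hup : ∀ l ∈ nonRealDiff E, 0 < l.im → solKer φ ψ l = ker l)
    {μ₀ : ℂ} (hμ₀ : μ₀ ∈ resolvSet (opB φ ψ B)) :
    solSpan φ ψ E ≤ detectableS φ ψ B μ₀ := by
  have hcl : IsClosed (detectableS φ ψ B μ₀ : Set L2) := Submodule.isClosed_topologicalClosure _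
  refine Submodule.topologicalClosure_minimal _ (Submodule.span_le.2 ?_) hcl
  rintro _ ⟨l, hl, rfl⟩
  obtain ⟨h, hsol⟩ : ∃ h, SolutionOp φ ψ B l h (solKer φ ψ l) :=
    ⟨_, by simpa using (hreg l hl).solutionOp_smul 1⟩
  obtain ⟨R, hR, -⟩ := id hμ₀
  obtain ⟨f, -, hf⟩ := hR (solKer φ ψ l)
  have hv := hsol.shift hf
  set v := solKer φ ψ l + (μ₀ - l) • (f : L2)
  have key : ∀ k ∈ nonRealDiff E, ∀ u, SolutionOp φ ψ B k h u →
      u - v ∈ detectableS φ ψ B μ₀ := by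
    intro k hk u hu
    have hk' := (hreg k hk).mem_resolvSet
    obtain ⟨R', hR', -⟩ := id hk'
    obtain ⟨g, -, hg⟩ := hR' v
    rw [hu.eq hk' (hv.shift hg), add_sub_cancel_left]
    refine Submodule.smul_mem _ _ (Submodule.le_topologicalClosure _ (Submodule.subset_span ?_))
    exact ⟨k, hk', g, rfl, h, by rwa [hg]⟩
  have hev : ∀ᶠ t : ℝ in atTop, (t : ℂ) * I ∈ nonRealDiff E ∧ 0 < ((t : ℂ) * I).im := by
    have hinj : Function.Injective fun t : ℝ => (t : ℂ) * I := fun s t hst => by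
      simpa using hst
    have h1 : ∀ᶠ t : ℝ in atTop, t ∉ (fun t : ℝ => (t : ℂ) * I) ⁻¹' E :=
      atTop_le_cofinite (hE.preimage hinj.injOn).compl_mem_cofinite
    filter_upwards [h1, eventually_gt_atTop 0] with t ht ht'
    have him : ((t : ℂ) * I).im = t := by simp
    exact ⟨⟨by simpa using ht'.ne', ht⟩, by rwa [him]⟩
  have hne : (Real.pi * I : ℂ) - B ≠ 0 := by
    obtain ⟨t, ht, ht'⟩ := hev.exists
    have := (hreg _ ht).ne_sgnPi
    rw [sgnPi_of_pos ht'] at this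
    exact sub_ne_zero.2 this.symm
  -- By `hup` the solution with datum `h` at `it` is `h / (πi - B)` times `ker (it)`, which tends to
  -- zero, so the differences in `key` converge to `-v`.
  have hv' : v ∈ detectableS φ ψ B μ₀ := by
    have h1 : Tendsto (fun t : ℝ => v - (h / (Real.pi * I - B)) • ker (t * I)) atTop (𝓝 v) := by
      have := (tendsto_ker_atTop 1 one_ne_zero).const_smul (h / (Real.pi * I - B))
      simpa using tendsto_const_nhds.sub this
    refine hcl.mem_of_tendsto h1 ?_
    filter_upwards [hev] with t ht
    have h2 := (hreg _ ht.1).solutionOp_smul (h / (Real.pi * I - B))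
    rw [sgnPi_of_pos ht.2, div_mul_cancel₀ _ hne, hup _ ht.1 ht.2] at h2
    rw [← neg_sub]
    exact Submodule.neg_mem _ (key _ ht.1 _ h2)
  have := Submodule.add_mem _ (key l hl _ hsol) hv'
  rwa [sub_add_cancel] at this

end Detectable

/-! ### The rank-one perturbation with simple rational data -/

theorem ne_of_im_pos_of_im_neg {a b : ℂ} (ha : 0 < a.im) (hb : b.im < 0) : a - b ≠ 0 := by
  intro h
  have := congrArg Complex.im h
  simp only [sub_im, zero_im] at this
  linarith

theorem inner_ker_res_ker {w l z : ℂ} (hw : 0 < w.im) (hl : l.im ≠ 0) (hz : z.im < 0) :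
    inner ℂ (ker (conj w)) (res l (ker z)) = (pair l w - pair l z) / (w - z) := by
  rw [inner_res_right hl, res_ker_comm (conj_im_ne_zero hl) (conj_im_ne_zero hw.ne'),
    ← inner_res_right hw.ne', res_ker hw.ne' hz.ne (sub_ne_zero.1 (ne_of_im_pos_of_im_neg hw hz)),
    inner_smul_right, inner_sub_right, div_eq_inv_mul]
  rfl

theorem inner_rational_res {w z β γ l : ℂ} (hw : 0 < w.im) (hl : l.im ≠ 0) (hz : z.im < 0) :
    inner ℂ (γ • ker (conj w)) (res l (β • ker z))
      = β * conj γ * ((pair l w - pair l z) / (w - z)) := by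
  rw [map_smul, inner_smul_left, inner_smul_right, inner_ker_res_ker hw hl hz]
  ring

section Rational

variable {w z β γ l₀ lt₀ : ℂ} (hw : 0 < w.im) (hz : z.im < 0)
  (hl₀ : l₀ = z + 2 * Real.pi * I * (β * conj γ) / (w - z))
  (hlt₀ : lt₀ = w + 2 * Real.pi * I * (β * conj γ) / (w - z))

include hw hz

include hl₀ in
theorem det_of_im_pos {l : ℂ} (hl : 0 < l.im) :
    1 + inner ℂ (γ • ker (conj w)) (res l (β • ker z)) = (l - l₀) / (l - z) := by
  have h1 := ne_of_im_pos_of_im_neg hw hz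
  have h2 := ne_of_im_pos_of_im_neg hl hz
  rw [inner_rational_res hw hl.ne' hz, pair_same (mul_pos hl hw), pair_pos_neg hl hz, hl₀]
  field_simp
  ring

include hlt₀ in
theorem det_of_im_neg {l : ℂ} (hl : l.im < 0) :
    1 + inner ℂ (γ • ker (conj w)) (res l (β • ker z)) = (l - lt₀) / (l - w) := by
  have h1 := ne_of_im_pos_of_im_neg hw hz
  have h2 := ne_of_im_pos_of_im_neg hw hl
  have h3 : l - w ≠ 0 := by rwa [← neg_sub, neg_ne_zero]
  rw [inner_rational_res hw hl.ne hz, pair_same (mul_pos_of_neg_of_neg hl hz),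
    pair_comm hl.ne hw.ne', pair_pos_neg hw hl, hlt₀]
  have h4 : (w - l)⁻¹ = -(l - w)⁻¹ := by rw [← neg_sub, inv_neg]
  rw [div_eq_mul_inv _ (w - l), h4]
  field_simp
  ring

include hl₀ hlt₀ in
-- Below the line `ker l` and `ψ` pair to zero, above it `ker l` and `φ` do. The points `l₀`, `lt₀`
-- are the possible zeros of the determinant; `w` and `z` are dropped to keep later partial
-- fractions free of double poles.
theorem regular_of_rational {B l : ℂ} (hB : B ≠ Real.pi * I) (hB' : B ≠ -(Real.pi * I))
    (hl : l ∈ nonRealDiff {l₀, lt₀, w, z}) :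
    Regular (γ • ker (conj w)) (β • ker z) B l := by
  obtain ⟨him, hE⟩ := hl
  simp only [Set.mem_insert_iff, Set.mem_singleton_iff, not_or] at hE
  have him : l.im ≠ 0 := him
  rcases him.lt_or_gt with h | h
  · refine ⟨him, ?_, ?_, by rwa [sgnPi_of_neg h]⟩
    · have : inner ℂ (ker (conj l)) (ker z) = 0 := pair_same (mul_pos_of_neg_of_neg h hz)
      rw [inner_smul_right (ker (conj l)), this, mul_zero, mul_zero]
    · rw [det_of_im_neg hw hz hlt₀ h]
      exact div_ne_zero (sub_ne_zero.2 hE.2.1) (sub_ne_zero.2 hE.2.2.1)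
  · refine ⟨him, ?_, ?_, by rwa [sgnPi_of_pos h]⟩
    · have : inner ℂ (ker (conj w)) (ker l) = 0 := pair_same (mul_pos hw h)
      rw [inner_smul_left, this, mul_zero, zero_mul]
    · rw [det_of_im_pos hw hz hl₀ h]
      exact div_ne_zero (sub_ne_zero.2 hE.1) (sub_ne_zero.2 hE.2.2.2)

omit hz in
theorem solKer_of_im_pos {l : ℂ} (hl : 0 < l.im) :
    solKer (γ • ker (conj w)) (β • ker z) l = ker l := by
  have : inner ℂ (ker (conj w)) (ker l) = 0 := pair_same (mul_pos hw hl)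
  rw [solKer, inner_smul_left, this, mul_zero, zero_div, zero_smul, sub_zero]

/-! ### The orthogonal complement, through the Cauchy transform. -/

include hl₀ hlt₀

theorem sub_mul_sub_add (l : ℂ) : (l - lt₀) * (l - z) + 2 * Real.pi * I * (β * conj γ)
    = (l - w) * (l - l₀) := by
  have h1 := ne_of_im_pos_of_im_neg hw hz
  rw [hl₀, hlt₀]
  field_simp
  ring

theorem smul_solKer_of_im_neg {l : ℂ} (hl : l.im < 0) (h1 : l ≠ lt₀) (h2 : l ≠ z) :
    ((l - lt₀) * (l - z)) • solKer (γ • ker (conj w)) (β • ker z) l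
      = ((l - w) * (l - l₀)) • ker l - (2 * Real.pi * I * (β * conj γ)) • ker z := by
  have hF : inner ℂ (γ • ker (conj w)) (ker l) = conj γ * (2 * Real.pi * I / (w - l)) := by
    rw [inner_smul_left, ← pair_pos_neg hw hl]
    rfl
  have h3 := ne_of_im_pos_of_im_neg hw hl
  have h4 : l - lt₀ ≠ 0 := sub_ne_zero.2 h1
  have h5 : l - z ≠ 0 := sub_ne_zero.2 h2
  have h6 : l - w ≠ 0 := by rwa [← neg_sub, neg_ne_zero]
  rw [solKer, hF, det_of_im_neg hw hz hlt₀ hl, map_smul, res_ker hl.ne hz.ne h2, smul_smul,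
    smul_smul, smul_sub, smul_smul, ← sub_mul_sub_add hw hz hl₀ hlt₀ l]
  have h7 : (l - lt₀) * (l - z) * (conj γ * (2 * Real.pi * I / (w - l)) / ((l - lt₀) / (l - w)) *
      (β * (l - z)⁻¹)) = -(2 * Real.pi * I * (β * conj γ)) := by
    have h8 : (w - l)⁻¹ = -(l - w)⁻¹ := by rw [← neg_sub, inv_neg]
    rw [div_eq_mul_inv _ (w - l), h8]
    field_simp
  simp only [mul_assoc] at h7 ⊢
  rw [h7]
  module

theorem mem_orthogonal_solSpan_iff (g : L2) :
    g ∈ (solSpan (γ • ker (conj w)) (β • ker z) {l₀, lt₀, w, z})ᗮ ↔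
      ∀ l ∈ nonRealDiff {l₀, lt₀, w, z}, (0 < l.im → inner ℂ g (ker l) = 0) ∧
        (l.im < 0 → (l - w) * (l - l₀) * inner ℂ g (ker l)
          = 2 * Real.pi * I * (β * conj γ) * inner ℂ g (ker z)) := by
  have h1 : g ∈ (solSpan (γ • ker (conj w)) (β • ker z) {l₀, lt₀, w, z})ᗮ ↔
      ∀ l ∈ nonRealDiff {l₀, lt₀, w, z},
        inner ℂ g (solKer (γ • ker (conj w)) (β • ker z) l) = 0 := by
    rw [solSpan, Submodule.orthogonal_closure, Submodule.mem_orthogonal']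
    constructor
    · intro h l hl
      exact h _ (Submodule.subset_span ⟨l, hl, rfl⟩)
    · intro h u hu
      have : Submodule.span ℂ (solKer (γ • ker (conj w)) (β • ker z) ''
          nonRealDiff {l₀, lt₀, w, z}) ≤ (Submodule.span ℂ {g})ᗮ := by
        rw [Submodule.span_le]
        rintro _ ⟨l, hl, rfl⟩
        exact Submodule.mem_orthogonal_singleton_iff_inner_right.2 (h l hl)
      exact Submodule.mem_orthogonal_singleton_iff_inner_right.1 (this hu)
  rw [h1]
  refine forall₂_congr fun l hl => ?_
  obtain ⟨him, hE⟩ := hl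
  simp only [Set.mem_insert_iff, Set.mem_singleton_iff, not_or] at hE
  have him : l.im ≠ 0 := him
  rcases him.lt_or_gt with h | h
  · have h2 := congrArg (inner ℂ g) (smul_solKer_of_im_neg hw hz hl₀ hlt₀ h hE.2.1 hE.2.2.2)
    rw [inner_smul_right, inner_sub_right, inner_smul_right, inner_smul_right] at h2
    have h3 : (l - lt₀) * (l - z) ≠ 0 :=
      mul_ne_zero (sub_ne_zero.2 hE.2.1) (sub_ne_zero.2 hE.2.2.2)
    simp only [h.not_gt, h, false_imp_iff, true_imp_iff, true_and]
    rw [← sub_eq_zero (a := (l - w) * (l - l₀) * inner ℂ g (ker l)), ← h2, mul_eq_zero]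
    simp [h3]
  · rw [solKer_of_im_pos hw h]
    simp [h, h.not_gt]

omit hw hz hl₀ hlt₀ in
theorem eq_zero_of_inner_ker {E : Set ℂ} (hE : E.Finite) {g : L2}
    (h : ∀ l ∈ nonRealDiff E, inner ℂ g (ker l) = 0) : g = 0 := by
  have h1 : (Submodule.span ℂ {g})ᗮ = ⊤ :=
    eq_top_of_ker_mem (Submodule.isClosed_orthogonal _) (dense_nonRealDiff hE) fun l hl =>
      Submodule.mem_orthogonal_singleton_iff_inner_right.2 (h l hl)
  have h2 : g ∈ (Submodule.span ℂ {g})ᗮ := h1 ▸ Submodule.mem_top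
  exact inner_self_eq_zero.1 (Submodule.mem_orthogonal_singleton_iff_inner_right.1 h2)

omit hw hz hl₀ hlt₀ in
-- At `l = l₀ - i/t` the factor `l - l₀` has size `1/t`, while `‖ker l‖² = π/|Im l| ≤ π t` since `Im
-- l₀ ≤ 0`. Hence `‖K‖² = O(1/t)`, also for real `l₀`.
theorem eq_zero_of_pole {E : Set ℂ} (hE : E.Finite) (hl₀' : l₀.im ≤ 0) {g : L2} {K : ℂ}
    (h : ∀ l ∈ nonRealDiff E, l.im < 0 → (l - w) * (l - l₀) * inner ℂ g (ker l) = K) :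
    K = 0 := by
  have hlim : Tendsto (fun t : ℝ => l₀ - (t⁻¹ : ℝ) * I) atTop (𝓝 l₀) := by
    have h1 : Tendsto (fun t : ℝ => ((t⁻¹ : ℝ) : ℂ)) atTop (𝓝 ((0 : ℝ) : ℂ)) :=
      (continuous_ofReal.tendsto 0).comp tendsto_inv_atTop_zero
    simpa using tendsto_const_nhds.sub (h1.mul_const I)
  have hbound : Tendsto (fun t : ℝ => ‖l₀ - (t⁻¹ : ℝ) * I - w‖ ^ 2 * (t⁻¹ * (‖g‖ ^ 2 * Real.pi)))
      atTop (𝓝 0) := by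
    simpa using ((hlim.sub_const w).norm.pow 2).mul
      (tendsto_inv_atTop_zero.mul_const (‖g‖ ^ 2 * Real.pi))
  have hinj : Function.Injective fun t : ℝ => l₀ - (t⁻¹ : ℝ) * I := fun s t hst => by
    simpa using hst
  have hev : ∀ᶠ t : ℝ in atTop, t ∉ (fun t : ℝ => l₀ - (t⁻¹ : ℝ) * I) ⁻¹' E :=
    atTop_le_cofinite (hE.preimage hinj.injOn).compl_mem_cofinite
  have hle : ‖K‖ ^ 2 ≤ 0 := by
    refine ge_of_tendsto hbound ?_
    filter_upwards [hev, eventually_gt_atTop 0] with t ht htpos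
    set l : ℂ := l₀ - (t⁻¹ : ℝ) * I with hl
    have him : l.im = l₀.im - t⁻¹ := by simp [hl]
    have ht' : 0 < t⁻¹ := inv_pos.2 htpos
    have hneg : l.im < 0 := by rw [him]; linarith
    have hsub : ‖l - l₀‖ = t⁻¹ := by
      have : l - l₀ = -((t⁻¹ : ℝ) * I) := by rw [hl]; ring
      rw [this, norm_neg, norm_mul, norm_I, mul_one, norm_real, Real.norm_of_nonneg ht'.le]
    have hker : t⁻¹ * ‖ker l‖ ^ 2 ≤ Real.pi := by
      rw [norm_ker_sq hneg.ne, mul_div_assoc', div_le_iff₀ (abs_pos.2 hneg.ne), mul_comm,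
        abs_of_neg hneg]
      exact mul_le_mul_of_nonneg_left (by rw [him]; linarith) Real.pi_pos.le
    calc ‖K‖ ^ 2 = ‖l - w‖ ^ 2 * (t⁻¹ ^ 2 * ‖inner ℂ g (ker l)‖ ^ 2) := by
          rw [← h l ⟨hneg.ne, ht⟩ hneg, norm_mul, norm_mul, hsub]
          ring
      _ ≤ ‖l - w‖ ^ 2 * (t⁻¹ ^ 2 * (‖g‖ * ‖ker l‖) ^ 2) := by
          gcongr
          exact norm_inner_le_norm _ _
      _ = ‖l - w‖ ^ 2 * (t⁻¹ * (‖g‖ ^ 2 * (t⁻¹ * ‖ker l‖ ^ 2))) := by ring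
      _ ≤ ‖l - w‖ ^ 2 * (t⁻¹ * (‖g‖ ^ 2 * Real.pi)) := by gcongr
  have : ‖K‖ = 0 := by nlinarith [norm_nonneg K]
  exact norm_eq_zero.1 this

theorem orthogonal_solSpan_eq_bot (hl₀' : l₀.im ≤ 0) :
    (solSpan (γ • ker (conj w)) (β • ker z) {l₀, lt₀, w, z})ᗮ = ⊥ := by
  have hE : ({l₀, lt₀, w, z} : Set ℂ).Finite := Set.toFinite _
  refine (Submodule.eq_bot_iff _).2 fun g hg => ?_
  rw [mem_orthogonal_solSpan_iff hw hz hl₀ hlt₀] at hg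
  have hK := eq_zero_of_pole hE hl₀' fun l hl => (hg l hl).2
  refine eq_zero_of_inner_ker hE fun l hl => ?_
  rcases (show l.im ≠ 0 from hl.1).lt_or_gt with h | h
  · have h1 := (hg l hl).2 h
    rw [hK] at h1
    have hE' := hl.2
    simp only [Set.mem_insert_iff, Set.mem_singleton_iff, not_or] at hE'
    exact (mul_eq_zero.1 h1).resolve_left
      (mul_ne_zero (sub_ne_zero.2 hE'.2.2.1) (sub_ne_zero.2 hE'.1))
  · exact (hg l hl).1 h

omit hz hl₀ hlt₀ in
theorem inner_double_ker_of_im_neg (hl₀' : 0 < l₀.im) {l : ℂ} (hl : l.im < 0) :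
    (l - w) * (l - l₀) * inner ℂ (res (conj w) (ker (conj l₀))) (ker l) = -(2 * Real.pi * I) := by
  have h1 := ne_of_im_pos_of_im_neg hw hl
  have h2 := ne_of_im_pos_of_im_neg hl₀' hl
  rw [← inner_res_right hw.ne', res_ker hw.ne' hl.ne (sub_ne_zero.1 h1), inner_smul_right,
    inner_sub_right, ← pair, ← pair, pair_same (mul_pos hl₀' hw), pair_pos_neg hl₀' hl]
  have h3 : (l - w) = -(w - l) := by ring
  have h4 : (l - l₀) = -(l₀ - l) := by ring
  rw [h3, h4]
  field_simp
  ring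

omit hz hl₀ hlt₀ in
theorem inner_double_ker_of_im_pos (hl₀' : 0 < l₀.im) {l : ℂ} (hl : 0 < l.im) (h : l ≠ w) :
    inner ℂ (res (conj w) (ker (conj l₀))) (ker l) = 0 := by
  rw [← inner_res_right hw.ne', res_ker hw.ne' hl.ne' h.symm, inner_smul_right,
    inner_sub_right, ← pair, ← pair, pair_same (mul_pos hl₀' hw), pair_same (mul_pos hl₀' hl)]
  simp

theorem orthogonal_solSpan_eq_span (hl₀' : 0 < l₀.im) :
    (solSpan (γ • ker (conj w)) (β • ker z) {l₀, lt₀, w, z})ᗮ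
      = Submodule.span ℂ {res (conj w) (ker (conj l₀))} := by
  have hE : ({l₀, lt₀, w, z} : Set ℂ).Finite := Set.toFinite _
  set g₀ := res (conj w) (ker (conj l₀)) with hg₀
  have hpi : (2 * Real.pi * I : ℂ) ≠ 0 := two_pi_I_ne_zero
  refine le_antisymm (fun g hg => ?_) ?_
  · rw [mem_orthogonal_solSpan_iff hw hz hl₀ hlt₀] at hg
    set K := 2 * Real.pi * I * (β * conj γ) * inner ℂ g (ker z)
    -- On the lower half-plane `g₀` yields the constant `-2πi` where `g` yields `K`; the conjugate
    -- appears because the inner product is conjugate-linear on the left.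
    set c : ℂ := conj (-K / (2 * Real.pi * I)) with hc
    refine Submodule.mem_span_singleton.2 ⟨c, ?_⟩
    refine (sub_eq_zero.1 (eq_zero_of_inner_ker hE fun l hl => ?_)).symm
    have hE' := hl.2
    simp only [Set.mem_insert_iff, Set.mem_singleton_iff, not_or] at hE'
    rw [inner_sub_left, inner_smul_left, hc, conj_conj]
    rcases (show l.im ≠ 0 from hl.1).lt_or_gt with h | h
    · have h1 := (hg l hl).2 h
      have h2 := inner_double_ker_of_im_neg hw hl₀' h
      rw [← hg₀] at h2
      refine (mul_eq_zero.1 (?_ : (l - w) * (l - l₀) * _ = 0)).resolve_left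
        (mul_ne_zero (sub_ne_zero.2 hE'.2.2.1) (sub_ne_zero.2 hE'.1))
      rw [mul_sub, h1, mul_left_comm, h2]
      field_simp
      ring
    · rw [(hg l hl).1 h, hg₀, inner_double_ker_of_im_pos hw hl₀' h hE'.2.2.1, mul_zero, sub_zero]
  · rw [Submodule.span_singleton_le_iff_mem, mem_orthogonal_solSpan_iff hw hz hl₀ hlt₀]
    intro l hl
    have hE' := hl.2
    simp only [Set.mem_insert_iff, Set.mem_singleton_iff, not_or] at hE'
    refine ⟨fun h => inner_double_ker_of_im_pos hw hl₀' h hE'.2.2.1, fun h => ?_⟩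
    -- At `l = z` this gives `2πi β γ̄ = (z - w)(z - l₀)`, so the required constant for `g₀` is
    -- again its value at `z`.
    have h1 := sub_mul_sub_add hw hz hl₀ hlt₀ z
    rw [sub_self, mul_zero, zero_add] at h1
    rw [inner_double_ker_of_im_neg hw hl₀' h, h1, inner_double_ker_of_im_neg hw hl₀' hz]

end Rational

/-! ### The exceptional vector and the values of the Riesz projection. -/

theorem double_ker_ne_zero {w l₀ : ℂ} (hw : 0 < w.im) (hl₀ : 0 < l₀.im) :
    res (conj w) (ker (conj l₀)) ≠ 0 := by
  intro h
  have h1 := inner_double_ker_of_im_neg hw hl₀ (l := -I) (by simp)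
  rw [h, inner_zero_left, mul_zero] at h1
  exact two_pi_I_ne_zero (neg_eq_zero.1 h1.symm)

theorem coeFn_double_ker {w l₀ : ℂ} (hw : 0 < w.im) (hl₀ : 0 < l₀.im) :
    ∀ᵐ x : ℝ, res (conj w) (ker (conj l₀)) x
      = 1 / (((x : ℂ) - conj w) * ((x : ℂ) - conj l₀)) := by
  filter_upwards [coeFn_res (conj_im_ne_zero hw.ne') (ker (conj l₀)),
    coeFn_ker (conj_im_ne_zero hl₀.ne')] with x h1 h2
  rw [h1, h2, one_div_mul_one_div]

theorem rieszPlus_eq_inner (f : L2) {k : ℂ} (hk : k.im ≠ 0) :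
    rieszPlus f k = 1 / (2 * Real.pi * I) * inner ℂ (ker (conj k)) f := by
  rw [rieszPlus, inner_ker_conj hk]
  congr 2
  funext x
  rw [one_div, div_eq_inv_mul]

theorem inner_double_ker_eq_zero_iff {w l₀ : ℂ} (hw : 0 < w.im) (hl₀ : 0 < l₀.im) (h : l₀ ≠ w)
    (f : L2) : inner ℂ (res (conj w) (ker (conj l₀))) f = 0 ↔ rieszPlus f w = rieszPlus f l₀ := by
  have hne : conj w - conj l₀ ≠ 0 := by
    rw [← map_sub, ne_eq, map_eq_zero, sub_eq_zero]
    exact h.symm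
  rw [rieszPlus_eq_inner f hw.ne', rieszPlus_eq_inner f hl₀.ne',
    mul_right_inj' (one_div_ne_zero two_pi_I_ne_zero),
    res_ker (conj_im_ne_zero hw.ne') (conj_im_ne_zero hl₀.ne') (sub_ne_zero.1 hne),
    inner_smul_left, inner_sub_left, mul_eq_zero, map_eq_zero, inv_eq_zero, or_iff_right hne,
    sub_eq_zero]

/-- The difference quotient equals the pairing with `res (conj k) (ker (conj w))`, which is
continuous up to the double pole `k = w`. -/
theorem hasDerivAt_rieszPlus {w : ℂ} (hw : 0 < w.im) (f : L2) :
    HasDerivAt (rieszPlus f)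
      (1 / (2 * Real.pi * I) * inner ℂ (res (conj w) (ker (conj w))) f) w := by
  rw [hasDerivAt_iff_tendsto_slope]
  have h1 : Tendsto (fun k : ℂ => res (conj k) (ker (conj w))) (𝓝 w)
      (𝓝 (res (conj w) (ker (conj w)))) :=
    (tendsto_res (conj_im_ne_zero hw.ne') (ker (conj w))).comp (continuous_conj.tendsto w)
  have h2 : Tendsto (fun k : ℂ => 1 / (2 * Real.pi * I : ℂ) *
      inner ℂ (res (conj k) (ker (conj w))) f) (𝓝[≠] w)
      (𝓝 (1 / (2 * Real.pi * I) * inner ℂ (res (conj w) (ker (conj w))) f)) :=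
    ((h1.inner tendsto_const_nhds).const_mul _).mono_left nhdsWithin_le_nhds
  refine h2.congr' ?_
  have h3 : ∀ᶠ k : ℂ in 𝓝 w, k.im ≠ 0 := continuous_im.continuousAt.eventually_ne hw.ne'
  filter_upwards [eventually_mem_nhdsWithin, nhdsWithin_le_nhds h3] with k hk hk'
  have hne : k - w ≠ 0 := sub_ne_zero.2 hk
  have hne' : conj k ≠ conj w := fun h => hk (by simpa using congrArg conj h)
  rw [slope_def_field, rieszPlus_eq_inner f hw.ne', rieszPlus_eq_inner f hk',
    res_ker (conj_im_ne_zero hk') (conj_im_ne_zero hw.ne') hne', inner_smul_left, inner_sub_left,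
    map_inv₀, map_sub, conj_conj, conj_conj]
  field_simp

theorem inner_double_ker_self_eq_zero_iff {w : ℂ} (hw : 0 < w.im) (f : L2) :
    inner ℂ (res (conj w) (ker (conj w))) f = 0 ↔ deriv (rieszPlus f) w = 0 := by
  rw [(hasDerivAt_rieszPlus hw f).deriv, mul_eq_zero]
  simp

theorem D_eq (φ ψ : L2) {l : ℂ} (hl : l.im ≠ 0) : D φ ψ l = 1 + inner ℂ φ (res l ψ) := by
  rw [D, inner_L2_eq]
  congr 1
  refine integral_congr_ae ?_
  filter_upwards [coeFn_res hl ψ] with x hx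
  rw [hx, mul_comm]

theorem detectable_eq_solSpan {w z β γ l₀ lt₀ B : ℂ} (hw : 0 < w.im) (hz : z.im < 0)
    (hl₀ : l₀ = z + 2 * Real.pi * I * (β * conj γ) / (w - z))
    (hlt₀ : lt₀ = w + 2 * Real.pi * I * (β * conj γ) / (w - z))
    (hB : B ≠ Real.pi * I) (hB' : B ≠ -(Real.pi * I)) :
    (resolvSet (opB (γ • ker (conj w)) (β • ker z) B)).Nonempty ∧
    detectableT (γ • ker (conj w)) (β • ker z) B
      = solSpan (γ • ker (conj w)) (β • ker z) {l₀, lt₀, w, z} ∧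
    ∀ μ₀ ∈ resolvSet (opB (γ • ker (conj w)) (β • ker z) B),
      detectableS (γ • ker (conj w)) (β • ker z) B μ₀
        = solSpan (γ • ker (conj w)) (β • ker z) {l₀, lt₀, w, z} := by
  have hE : ({l₀, lt₀, w, z} : Set ℂ).Finite := Set.toFinite _
  have hreg := fun l hl => regular_of_rational (l := l) hw hz hl₀ hlt₀ hB hB' hl
  refine ⟨?_, detectableT_eq_solSpan hE hreg, fun μ₀ hμ₀ => le_antisymm
    (detectableS_le_solSpan hE hreg hμ₀)
    (solSpan_le_detectableS hE hreg (fun l _ h => solKer_of_im_pos hw h) hμ₀)⟩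
  obtain ⟨l, hl⟩ := (dense_nonRealDiff hE).nonempty
  exact ⟨l, (hreg l hl).mem_resolvSet⟩

theorem orthogonal_solSpan_ne_bot_iff {w z β γ l₀ lt₀ : ℂ} (hw : 0 < w.im) (hz : z.im < 0)
    (hl₀ : l₀ = z + 2 * Real.pi * I * (β * conj γ) / (w - z))
    (hlt₀ : lt₀ = w + 2 * Real.pi * I * (β * conj γ) / (w - z)) :
    (solSpan (γ • ker (conj w)) (β • ker z) {l₀, lt₀, w, z})ᗮ ≠ ⊥ ↔ 0 < l₀.im := by
  constructor
  · intro h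
    by_contra h'
    exact h (orthogonal_solSpan_eq_bot hw hz hl₀ hlt₀ (not_lt.1 h'))
  · intro h h'
    rw [orthogonal_solSpan_eq_span hw hz hl₀ hlt₀ h, Submodule.span_singleton_eq_bot] at h'
    exact double_ker_ne_zero hw h h'

theorem mem_solSpan_iff_of_orthogonal {φ ψ g₀ : L2} {E : Set ℂ}
    (h : (solSpan φ ψ E)ᗮ = Submodule.span ℂ {g₀}) (f : L2) :
    f ∈ solSpan φ ψ E ↔ inner ℂ g₀ f = 0 := by
  have h1 : (solSpan φ ψ E)ᗮᗮ = solSpan φ ψ E := by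
    rw [Submodule.orthogonal_orthogonal_eq_closure]
    exact (isClosed_solSpan φ ψ E).submodule_topologicalClosure_eq
  rw [← h1, h, Submodule.mem_orthogonal_singleton_iff_inner_right]

theorem solSpan_eq_top_of_orthogonal {φ ψ : L2} {E : Set ℂ} (h : (solSpan φ ψ E)ᗮ = ⊥) :
    solSpan φ ψ E = ⊤ := by
  rw [← (isClosed_solSpan φ ψ E).submodule_topologicalClosure_eq]
  exact (Submodule.topologicalClosure_eq_top_iff).2 h

end Friedrichs

open Friedrichs in
theorem mainTheorem7 (z₁ w₁ α : ℂ) (hz : z₁.im < 0) (hw : 0 < w₁.im)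
    (φ ψ : L2)
    (hψ : ∀ᵐ x : ℝ, ψ x = α / ((x : ℂ) - z₁))
    (hφ : ∀ᵐ x : ℝ, conj (φ x) = 1 / ((x : ℂ) - w₁))
    (l₀ lt₀ : ℂ)
    (hl₀ : l₀ = z₁ + 2 * Real.pi * I * α / (w₁ - z₁))
    (hlt₀ : lt₀ = w₁ + 2 * Real.pi * I * α / (w₁ - z₁))
    (B : ℂ) (hB : B ≠ Real.pi * I) (hB' : B ≠ -(Real.pi * I)) :
    -- the function `D` in the two half-planes
    (∀ lam : ℂ, 0 < lam.im → D φ ψ lam = (lam - l₀) / (lam - z₁)) ∧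
    (∀ lam : ℂ, lam.im < 0 → D φ ψ lam = (lam - lt₀) / (lam - w₁)) ∧
    -- the resolvent sets of `A_B` and of the operator with boundary parameter `B*` are non-empty
    (resolvSet (opB φ ψ B)).Nonempty ∧
    (resolvSet (opB ψ φ (conj B))).Nonempty ∧
    ∀ μ₀ ∈ resolvSet (opB φ ψ B), ∀ μt₀ ∈ resolvSet (opB ψ φ (conj B)),
      -- the definitions of the detectable subspaces agree
      detectableS φ ψ B μ₀ = detectableT φ ψ B ∧
      detectableS ψ φ (conj B) μt₀ = detectableT ψ φ (conj B) ∧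
      -- the orthogonal complement
      ((detectableS φ ψ B μ₀)ᗮ ≠ ⊥ ↔ 0 < l₀.im) ∧
      (0 < l₀.im →
        Module.finrank ℂ (detectableS φ ψ B μ₀)ᗮ = 1 ∧
        (∃ g₀ : L2,
          (∀ᵐ x : ℝ, g₀ x = 1 / (((x : ℂ) - conj w₁) * ((x : ℂ) - conj l₀))) ∧
          (detectableS φ ψ B μ₀)ᗮ = Submodule.span ℂ {g₀}) ∧
        (l₀ ≠ w₁ → ∀ f : L2,
          f ∈ detectableS φ ψ B μ₀ ↔ rieszPlus f w₁ = rieszPlus f l₀) ∧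
        (l₀ = w₁ → ∀ f : L2,
          f ∈ detectableS φ ψ B μ₀ ↔ deriv (rieszPlus f) w₁ = 0)) ∧
      -- the space for the exchanged roles of `φ` and `ψ`
      ((detectableS ψ φ (conj B) μt₀)ᗮ ≠ ⊥ ↔ lt₀.im < 0) ∧
      (0 < l₀.im → 0 < lt₀.im) ∧
      (lt₀.im < 0 → l₀.im < 0) ∧
      (detectableS φ ψ B μ₀ = ⊤ ∨ detectableS ψ φ (conj B) μt₀ = ⊤) := by
  have hφ' : φ = (1 : ℂ) • ker (conj w₁) := by
    rw [one_smul]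
    refine Lp.ext ?_
    filter_upwards [hφ, coeFn_ker (conj_im_ne_zero hw.ne')] with x h1 h2
    rw [h2, ← conj_conj (φ x), h1]
    simp
  have hψ' : ψ = α • ker z₁ := by
    refine Lp.ext ?_
    filter_upwards [hψ, coeFn_ker hz.ne, Lp.coeFn_smul α (ker z₁)] with x h1 h2 h3
    rw [h1, h3, Pi.smul_apply, h2, smul_eq_mul, mul_one_div]
  have hψ'' : ψ = α • ker (conj (conj z₁)) := by rw [conj_conj, hψ']
  have hz' : 0 < (conj z₁).im := by simpa using hz
  have hw' : (conj w₁).im < 0 := by simpa using hw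
  have e₀ : l₀ = z₁ + 2 * Real.pi * I * (α * conj 1) / (w₁ - z₁) := by
    rw [hl₀, map_one, mul_one]
  have et₀ : lt₀ = w₁ + 2 * Real.pi * I * (α * conj 1) / (w₁ - z₁) := by
    rw [hlt₀, map_one, mul_one]
  have hconj : conj (2 * Real.pi * I * α / (w₁ - z₁))
      = 2 * Real.pi * I * (1 * conj α) / (conj z₁ - conj w₁) := by
    rw [map_div₀, map_sub, ← neg_sub (conj z₁), div_neg, ← neg_div]
    simp [map_ofNat]
  have e₁ : conj lt₀ = conj w₁ + 2 * Real.pi * I * (1 * conj α) / (conj z₁ - conj w₁) := by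
    rw [hlt₀, map_add, hconj]
  have et₁ : conj l₀ = conj z₁ + 2 * Real.pi * I * (1 * conj α) / (conj z₁ - conj w₁) := by
    rw [hl₀, map_add, hconj]
  have hBc : conj B ≠ Real.pi * I := fun h => hB' (by
    rw [← conj_conj B, h]
    simp)
  have hBc' : conj B ≠ -(Real.pi * I) := fun h => hB (by
    rw [← conj_conj B, h]
    simp)
  obtain ⟨n1, t1, s1⟩ := detectable_eq_solSpan hw hz e₀ et₀ hB hB'
  obtain ⟨n2, t2, s2⟩ := detectable_eq_solSpan hz' hw' e₁ et₁ hBc hBc'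
  have o1 := orthogonal_solSpan_ne_bot_iff hw hz e₀ et₀
  have o2 := orthogonal_solSpan_ne_bot_iff hz' hw' e₁ et₁
  -- The right-hand side is positive, which yields both half-plane implications and excludes two
  -- proper subspaces at once.
  have him : lt₀.im - l₀.im = w₁.im - z₁.im := by
    rw [hl₀, hlt₀]
    simp only [add_im]
    ring
  rw [← hφ', ← hψ'] at n1 t1 s1 o1
  rw [← hψ'', ← hφ'] at n2 t2 s2 o2
  refine ⟨fun l hl => ?_, fun l hl => ?_, n1, n2, fun μ₀ hμ₀ μt₀ hμt₀ => ?_⟩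
  · rw [D_eq φ ψ hl.ne', hφ', hψ', det_of_im_pos hw hz e₀ hl]
  · rw [D_eq φ ψ hl.ne, hφ', hψ', det_of_im_neg hw hz et₀ hl]
  rw [s1 μ₀ hμ₀, s2 μt₀ hμt₀, t1, t2]
  refine ⟨rfl, rfl, o1, fun h => ?_, ?_, fun h => by linarith, fun h => by linarith, ?_⟩
  · have hs := orthogonal_solSpan_eq_span hw hz e₀ et₀ h
    rw [← hφ', ← hψ'] at hs
    refine ⟨?_, ⟨_, coeFn_double_ker hw h, hs⟩, fun hne f => ?_, fun heq f => ?_⟩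
    · rw [hs]
      exact finrank_span_singleton (double_ker_ne_zero hw h)
    · rw [mem_solSpan_iff_of_orthogonal hs, inner_double_ker_eq_zero_iff hw h hne]
    · rw [mem_solSpan_iff_of_orthogonal hs, heq, inner_double_ker_self_eq_zero_iff hw]
  · rw [o2]
    simp
  · by_cases h : 0 < l₀.im
    · refine Or.inr (solSpan_eq_top_of_orthogonal (not_not.1 fun h' => ?_))
      have h1 := o2.1 h'
      simp only [conj_im] at h1
      linarith
    · exact Or.inl (solSpan_eq_top_of_orthogonal (not_not.1 fun h' => h (o1.1 h')))
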